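/- Let $n\ge 0$ and let $X$ be a finite multiset of nonzero vectors that spans $\mathbb{R}^n$, equipped with an arbitrary total order $\prec$ (repeated vectors are distinct elements of $X$, and all subsets and cardinalities are taken with multiplicity). **Notation.** Let $\Pi=\mathbb{C}[t_1,\dots,t_n]$. For $p\in\Pi$ and a formal power series $f\in\mathbb{C}[[t_1,\dots,t_n]]$ let $p(D)=p(\partial/\partial t_1,\dots,\partial/\partial t_n)$ and $\langle p,f\rangle=(p(D)f)(0)$. Let $e_\alpha(t)=e^{\alpha\cdot t}$. For an ideal $I\subset\Pi$ with variety $\mathrm{Var}(I)\subset\mathbb{C}^n$, let $$\ker I=\mathrm{span}\{e_\alpha p:\ \alpha\in\mathrm{Var}(I),\ p\in\Pi,\ \langle q,e_\alpha p\rangle=0\ \ \forall q\in I\}.$$ For a power series $f\neq0$ let $f_\downarrow$ be its nonzero homogeneous component of lowest degree, and $0_\downarrow=0$. For a finite $\sigma\subset\mathbb{R}^n$ let $\Pi(\sigma)=\mathrm{span}\{f_\downarrow: f\in\mathrm{span}\{e_\alpha:\alpha\in\sigma\}\}$; $\sigma$ is *correct* for a subspace $P\subset\Pi$ if the restriction $P\to\mathbb{C}^\sigma$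 is bijective. For $x\in\mathbb{R}^n$ put $p_x(t)=x\cdot t$, and for $Y\subset X$ put $p_Y=\prod_{y\in Y}p_y$. * $\mathbb{B}_-(X)$ is the set of internal bases: those $B\subset X$ that are bases of $\mathbb{R}^n$ and such that no $b\in B$ is the $\prec$-last element of $X\setminus\mathrm{span}(B\setminus b)$. * $L_-(X)$ is the set of $Y\subset X$ that meet every $B\in\mathbb{B}_-(X)$; $\mathcal{J}_-(X)$ is the ideal generated by $\{p_Y:Y\in L_-(X)\}$; and $\mathcal{D}_-(X)=\{f\in\Pi: p_Y(D)f=0\ \ \forall\,Y\in L_-(X)\}$. * $\mathcal{P}_-(X)=\bigcap_{x\in X}\mathcal{P}(X\setminus x)$, where $\mathcal{P}(A)=\mathrm{span}\{p_Y: Y\subset A,\ \mathrm{rank}(A\setminus Y)=n\}$ for $A\subset X$ (so $\mathcal{P}(A)=0$ if $A$ does not span $\mathbb{R}^n$; an empty intersection is $\Pi$). * $\mathcal{I}_-(X)$ is the ideal generated by the polynomials $p_{\eta_H}^{m(H)-1}$, where $H$ runs over the linear hyperplanes of $\mathbb{R}^n$ spanned by vectors of $X$, $\eta_H\ne0$ is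 a normal of $H$, and $m(H)=\#(X\setminus H)$. * For $\lambda\in\mathbb{R}^X$, generic in the sense that no $n+1$ of the hyperplanes $\{t: x\cdot t=\lambda_x\}$, $x\in X$, have a common point, $V_-(X,\lambda)$ is the set of the points $v_B$, $B\in\mathbb{B}_-(X)$, where $v_B$ is the unique common point of the hyperplanes with $x\in B$. **Theorem.** 1. $\mathcal{P}_-(X)$ and $\mathcal{D}_-(X)$ are finite-dimensional and $\dim\mathcal{P}_-(X)=\dim\mathcal{D}_-(X)=\#\mathbb{B}_-(X)$. 2. The map $p\mapsto\langle p,\cdot\rangle$ is a bijection from $\mathcal{D}_-(X)$ onto the dual space $\mathcal{P}_-(X)'$. 3. $\mathcal{D}_-(X)=\ker\mathcal{J}_-(X)$, and $\mathcal{D}_-(X)=\Pi(V_-(X,\lambda))$ for every generic $\lambda$. 4. For every generic $\lambda$, the set $V_-(X,\lambda)$ is correct for $\mathcal{D}_-(X)$ as well as for $\mathcal{P}_-(X)$. 5. $\mathcal{P}_-(X)=\ker\mathcal{I}_-(X)$. 6. $\Pi=\mathcal{P}_-(X)\oplus\mathcal{J}_-(X)$. -/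

import Mathlib

/-!  Zonotopal algebra: polynomial spaces and ideals attached to a finite ordered multiset of
vectors `X : ι → ℝⁿ`.  A sub-multiset of `X` is a finset of indices, so repeated vectors are
distinct elements of the multiset.  -/

namespace ZonotopalAlgebra

open MvPolynomial

/-- `Π = ℂ[t₁, …, tₙ]`. -/
abbrev Poly (n : ℕ) : Type := MvPolynomial (Fin n) ℂ

/-- `ℂ[[t₁, …, tₙ]]`. -/
abbrev Series (n : ℕ) : Type := MvPowerSeries (Fin n) ℂ

/-- The inclusion of polynomials into formal power series. -/
noncomputable def toSeries (n : ℕ) : Poly n →ₗ[ℂ] Series n :=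
  (coeToMvPowerSeries.algHom (σ := Fin n) (R := ℂ) ℂ).toLinearMap

/-! ### Differential operators, pairing, kernels of ideals -/

/-- `D^a = ∂₁^{a₁} ⋯ ∂ₙ^{aₙ}` on formal power series. -/
noncomputable def partialPow {n : ℕ} (a : Fin n →₀ ℕ) : Module.End ℂ (Series n) :=
  (List.ofFn fun i : Fin n =>
    ((MvPowerSeries.pderiv ℂ i : Series n →ₗ[ℂ] Series n) : Module.End ℂ (Series n)) ^ a i).prod

/-- The differential operator `p(D)` on formal power series. -/
noncomputable def diffOp {n : ℕ} (p : Poly n) : Module.End ℂ (Series n) :=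
  ∑ a ∈ p.support, p.coeff a • partialPow a

/-- The pairing `⟨p, f⟩ = (p(D) f)(0)`, as a linear functional of the power series `f`. -/
noncomputable def pairing {n : ℕ} (p : Poly n) : Series n →ₗ[ℂ] ℂ :=
  (MvPowerSeries.coeff (0 : Fin n →₀ ℕ)).comp (diffOp p)

/-- The exponential `e_α(t) = exp(α · t)` as a formal power series. -/
noncomputable def expSeries {n : ℕ} (α : Fin n → ℂ) : Series n :=
  fun a => ∏ i, α i ^ a i / (Nat.factorial (a i) : ℂ)

/-- The variety in `ℂⁿ` of an ideal of `Π`. -/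
def variety {n : ℕ} (I : Ideal (Poly n)) : Set (Fin n → ℂ) :=
  {θ | ∀ q ∈ I, eval θ q = 0}

/-- The kernel of an ideal `I`: the span of all exponential polynomials `e_α p`, with `α` in the
variety of `I` and `p ∈ Π`, that are orthogonal to `I` under the pairing. -/
noncomputable def idealKer {n : ℕ} (I : Ideal (Poly n)) : Submodule ℂ (Series n) :=
  Submodule.span ℂ {g | ∃ α ∈ variety I, ∃ p : Poly n,
    g = expSeries α * toSeries n p ∧ ∀ q ∈ I, pairing q g = 0}

/-! ### The least map and interpolation -/

/-- The least map `f ↦ f↓`: the nonzero homogeneous component of `f` of lowest degree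
(and `0↓ = 0`), as a polynomial. -/
noncomputable def least {n : ℕ} (f : Series n) : Poly n :=
  MvPowerSeries.truncTotal (f.order.toNat + 1)
    (MvPowerSeries.homogeneousComponent f.order.toNat f)

/-- `Exp(σ)`, the span of the exponentials `e_α`, `α ∈ σ`. -/
noncomputable def expSpace {n : ℕ} (σ : Set (Fin n → ℝ)) : Submodule ℂ (Series n) :=
  Submodule.span ℂ ((fun α : Fin n → ℝ => expSeries fun i => (α i : ℂ)) '' σ)

/-- `Π(σ)`, the span of the polynomials `f↓`, `f ∈ Exp(σ)`. -/
noncomputable def leastSpace {n : ℕ} (σ : Set (Fin n → ℝ)) : Submodule ℂ (Poly n) :=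
  Submodule.span ℂ (least '' (expSpace σ : Set (Series n)))

/-- `σ` is correct for `P`: the restriction map `P → ℂ^σ` is invertible. -/
def IsCorrect {n : ℕ} (σ : Set (Fin n → ℝ)) (P : Submodule ℂ (Poly n)) : Prop :=
  Function.Bijective fun (p : P) (v : σ) => eval (fun i => ((v : Fin n → ℝ) i : ℂ)) (p : Poly n)

/-! ### Linear forms and the matroid of `X` -/

/-- The linear form `p_x : t ↦ x · t`. -/
noncomputable def linForm {n : ℕ} (x : Fin n → ℝ) : Poly n :=
  ∑ i, C (x i : ℂ) * MvPolynomial.X i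

/-- `p_Y = ∏_{y ∈ Y} p_y`. -/
noncomputable def prodForm {n : ℕ} {ι : Type*} (X : ι → Fin n → ℝ) (Y : Finset ι) : Poly n :=
  ∏ i ∈ Y, linForm (X i)

/-- `B ∈ 𝔹(X)`: the vectors of `B ⊂ X` form a basis of `ℝⁿ`. -/
def IsBasis {n : ℕ} {ι : Type*} (X : ι → Fin n → ℝ) (B : Finset ι) : Prop :=
  LinearIndepOn ℝ X (B : Set ι) ∧ Submodule.span ℝ (X '' (B : Set ι)) = ⊤

/-- `b` is internally active in `B`: it is the last element of `X \ H`, `H = span (B \ b)`. -/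
def InternallyActive {n : ℕ} {ι : Type*} [LinearOrder ι] (X : ι → Fin n → ℝ)
    (B : Finset ι) (b : ι) : Prop :=
  IsGreatest {j | X j ∉ Submodule.span ℝ (X '' (B.erase b : Set ι))} b

/-- `𝔹₋(X)`: the internal bases, i.e. the bases without internally active elements. -/
def internalBases {n : ℕ} {ι : Type*} [LinearOrder ι] (X : ι → Fin n → ℝ) : Set (Finset ι) :=
  {B | IsBasis X B ∧ ∀ b ∈ B, ¬ InternallyActive X B b}

/-- `L₋(X)`: the barely long subsets of `X`, which meet every internal basis. -/
def barelyLong {n : ℕ} {ι : Type*} [LinearOrder ι] (X : ι → Fin n → ℝ) : Set (Finset ι) :=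
  {Y | ∀ B ∈ internalBases X, (Y ∩ B).Nonempty}

/-- `H ∈ 𝓕(X)`: a linear hyperplane spanned by the vectors of `X` that it contains. -/
def IsFacetHyperplane {n : ℕ} {ι : Type*} (X : ι → Fin n → ℝ)
    (H : Submodule ℝ (Fin n → ℝ)) : Prop :=
  Module.finrank ℝ H + 1 = n ∧ Submodule.span ℝ (Set.range X ∩ (H : Set (Fin n → ℝ))) = H

/-- `m(H) = #(X \ H)`, counted with multiplicity. -/
noncomputable def facetMult {n : ℕ} {ι : Type*} (X : ι → Fin n → ℝ)
    (H : Submodule ℝ (Fin n → ℝ)) : ℕ :=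
  {i | X i ∉ H}.ncard

/-! ### Spaces and ideals -/

/-- The central space `𝓟(A)` of the sub-multiset `A` of `X`: the span of `p_Y` over the short
subsets `Y` of `A`, i.e. those with `rank (A \ Y) = n`. -/
noncomputable def centralP {n : ℕ} {ι : Type*} [DecidableEq ι] (X : ι → Fin n → ℝ)
    (A : Finset ι) : Submodule ℂ (Poly n) :=
  Submodule.span ℂ {p | ∃ Y ⊆ A,
    Submodule.span ℝ (X '' ((A \ Y : Finset ι) : Set ι)) = ⊤ ∧ p = prodForm X Y}

/-- The internal space `𝓟₋(X) = ⋂_{x ∈ X} 𝓟(X \ x)`. -/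
noncomputable def internalP {n : ℕ} {ι : Type*} [Fintype ι] [DecidableEq ι]
    (X : ι → Fin n → ℝ) : Submodule ℂ (Poly n) :=
  ⨅ x : ι, centralP X (Finset.univ.erase x)

/-- The ideal `𝓘₋(X)`, generated by `p_η^{m(H) - 1}` for the facet hyperplanes `H` and their
nonzero normals `η`.  (If `X` spans `ℝⁿ` then `m(H) ≥ 1`, and the normals of `H` are nonzero
multiples of each other.) -/
noncomputable def internalI {n : ℕ} {ι : Type*} (X : ι → Fin n → ℝ) : Ideal (Poly n) :=
  Ideal.span {q | ∃ (H : Submodule ℝ (Fin n → ℝ)) (η : Fin n → ℝ), IsFacetHyperplane X H ∧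
    η ≠ 0 ∧ (∀ h ∈ H, η ⬝ᵥ h = 0) ∧ q = linForm η ^ (facetMult X H - 1)}

/-- The ideal `𝓙₋(X)`, generated by the `p_Y` with `Y` barely long. -/
noncomputable def internalJ {n : ℕ} {ι : Type*} [LinearOrder ι] (X : ι → Fin n → ℝ) :
    Ideal (Poly n) :=
  Ideal.span (prodForm X '' barelyLong X)

/-- The space `𝓓₋(X)` of the polynomials `f` with `p_Y(D) f = 0` for every barely long `Y`. -/
noncomputable def internalD {n : ℕ} {ι : Type*} [LinearOrder ι] (X : ι → Fin n → ℝ) :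
    Submodule ℂ (Poly n) where
  carrier := {f | ∀ Y ∈ barelyLong X, diffOp (prodForm X Y) (toSeries n f) = 0}
  add_mem' hf hg Y hY := by rw [map_add, map_add, hf Y hY, hg Y hY, add_zero]
  zero_mem' Y _ := by rw [map_zero, map_zero]
  smul_mem' c f hf Y hY := by rw [map_smul, map_smul, hf Y hY, smul_zero]

/-! ### The hyperplane arrangement -/

/-- `λ` is generic: any `n + 1` of the hyperplanes `x · t = λ_x`, `x ∈ X`, have no common point. -/
def IsGeneric {n : ℕ} {ι : Type*} (X : ι → Fin n → ℝ) (lam : ι → ℝ) : Prop :=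
  ∀ S : Finset ι, S.card = n + 1 → ¬ ∃ t : Fin n → ℝ, ∀ i ∈ S, X i ⬝ᵥ t = lam i

/-- `V₋(X, λ)`: the vertices `v_B` of the arrangement that come from internal bases `B`. -/
def internalVertices {n : ℕ} {ι : Type*} [LinearOrder ι] (X : ι → Fin n → ℝ) (lam : ι → ℝ) :
    Set (Fin n → ℝ) :=
  {v | ∃ B ∈ internalBases X, ∀ i ∈ B, X i ⬝ᵥ v = lam i}

end ZonotopalAlgebra

open ZonotopalAlgebra

/-! Fix a generic λ and let V be the set of internal vertices. Genericity makes B ↦ v_B injective,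
so V has as many points as there are internal bases. Everything is read off from one circular chain
of dimensions: #V ≤ dim Π(V) ≤ dim 𝓓₋ ≤ dim 𝓟₋ ≤ #V. Equality throughout gives the dimensions, 𝓓₋ =
Π(V), both correctness statements and, with a generic λ chosen by `exists_isGeneric`, the duality.
The four links are the following.

Restriction Π(V) → ℂ^V is onto (`evalMap_leastSpace_surjective`): a functional on ℂ^V is pairing
with an exponential sum, and the least part of the conjugate sum pairs with it to a positive number.

Π(V) lies in 𝓓₋ (`least_mem_internalD`): for Y barely long, the product of the affine forms x·t -
λ_x over Y vanishes on V and has p_Y as its top part, so p_Y(D) kills least parts of exponential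
sums over V.

𝓓₋ embeds in the dual of 𝓟₋ (`internalPairing_injective`): 𝓓₋ is the orthogonal complement of 𝓙₋,
and 𝓟₋ + 𝓙₋ = Π (`internalP_sup_internalJ`). For the latter, a p_Y that misses an internal basis is
corrected by products of smaller weight to an element of 𝓟₋; the counting behind this is
`card_modified_add_two_le`.

An element of 𝓟₋ that vanishes on V is zero (`eq_zero_of_eval_internalVertices_eq_zero`), by
deletion and contraction.

The last two links rest on the differential description 𝓟₋ = 𝓘₋^⊥ (`internalP_eq_idealPerp`): 𝓟₋
consists of the polynomials killed by the (m(H) - 1)-st normal derivative for every facet hyperplane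
H. Its deletion-contraction proof works with polynomials modulo those vanishing on a flat, through
the predicate `FacetKilled`. The statements about kernels then only need that the varieties of 𝓘₋
and 𝓙₋ contain no point but the origin (`map_idealPerp_eq_idealKer`). Directness of the sum in (6)
follows from the duality. -/

namespace ZonotopalAlgebra

open MvPolynomial

section

variable {n : ℕ}

/-! ### The pairing in coordinates -/

/-- The multi-factorial `a! = ∏ aᵢ!`. -/
noncomputable def multiFactorial (a : Fin n →₀ ℕ) : ℂ :=
  ∏ i : Fin n, (Nat.factorial (a i) : ℂ)

theorem multiFactorial_ne_zero (a : Fin n →₀ ℕ) : multiFactorial a ≠ 0 :=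
  Finset.prod_ne_zero_iff.2 fun _ _ => Nat.cast_ne_zero.2 (Nat.factorial_ne_zero _)

theorem multiFactorial_zero : multiFactorial (0 : Fin n →₀ ℕ) = 1 := by
  simp [multiFactorial]

theorem multiFactorial_add_single (a : Fin n →₀ ℕ) (i : Fin n) :
    multiFactorial (a + Finsupp.single i 1) = multiFactorial a * (a i + 1) := by
  classical
  unfold multiFactorial
  rw [← Finset.mul_prod_erase _ _ (Finset.mem_univ i),
    ← Finset.mul_prod_erase Finset.univ (fun j => ((a j).factorial : ℂ)) (Finset.mem_univ i)]
  have h : ∀ j ∈ Finset.univ.erase i,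
      (((a + Finsupp.single i 1 : Fin n →₀ ℕ) j).factorial : ℂ) = ((a j).factorial : ℂ) := by
    intro j hj
    simp [Finsupp.single_eq_of_ne (Finset.ne_of_mem_erase hj)]
  rw [Finset.prod_congr rfl h]
  simp [Nat.factorial_succ]
  ring

theorem multiFactorial_mul_coeff_pderiv_pow (i : Fin n) (k : ℕ) (b : Fin n →₀ ℕ) (f : Series n) :
    multiFactorial b * MvPowerSeries.coeff b
      (((MvPowerSeries.pderiv ℂ i : Series n →ₗ[ℂ] Series n) : Module.End ℂ (Series n)) ^ k <| f) =
    multiFactorial (b + Finsupp.single i k) *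
      MvPowerSeries.coeff (b + Finsupp.single i k) f := by
  induction k generalizing b with
  | zero => simp
  | succ k ih =>
    rw [pow_succ']
    have h1 : MvPowerSeries.coeff b ((((MvPowerSeries.pderiv ℂ i : Series n →ₗ[ℂ] Series n) :
        Module.End ℂ (Series n)) * ((MvPowerSeries.pderiv ℂ i : Series n →ₗ[ℂ] Series n) :
        Module.End ℂ (Series n)) ^ k) f) = MvPowerSeries.coeff (b + Finsupp.single i 1)
        ((((MvPowerSeries.pderiv ℂ i : Series n →ₗ[ℂ] Series n) :
        Module.End ℂ (Series n)) ^ k) f) * (b i + 1) := by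
      rw [Module.End.mul_apply]
      exact MvPowerSeries.coeff_pderiv _ _
    rw [h1, mul_comm (MvPowerSeries.coeff _ _), ← mul_assoc, ← multiFactorial_add_single, ih,
      add_assoc, ← Finsupp.single_add, add_comm 1 k]

theorem multiFactorial_mul_coeff_partialPow (a b : Fin n →₀ ℕ) (f : Series n) :
    multiFactorial b * MvPowerSeries.coeff b (partialPow a f) =
      multiFactorial (a + b) * MvPowerSeries.coeff (a + b) f := by
  have key : ∀ (l : List (Fin n)) (b : Fin n →₀ ℕ),
      multiFactorial b * MvPowerSeries.coeff b ((l.map fun i : Fin n =>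
        ((MvPowerSeries.pderiv ℂ i : Series n →ₗ[ℂ] Series n) :
          Module.End ℂ (Series n)) ^ a i).prod f) =
      multiFactorial (b + (l.map fun i => Finsupp.single i (a i)).sum) *
        MvPowerSeries.coeff (b + (l.map fun i => Finsupp.single i (a i)).sum) f := by
    intro l
    induction l with
    | nil => intro b; simp
    | cons i l ih =>
      intro b
      rw [List.map_cons, List.prod_cons, Module.End.mul_apply,
        multiFactorial_mul_coeff_pderiv_pow, ih, List.map_cons, List.sum_cons, add_assoc]
  have h2 : ((List.finRange n).map fun i => Finsupp.single i (a i)).sum = a := by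
    rw [← List.ofFn_eq_map, List.sum_ofFn]
    exact Finsupp.univ_sum_single a
  rw [partialPow, List.ofFn_eq_map, key, h2, add_comm]

/-- The pairing as a linear functional of the polynomial. -/
noncomputable def pairingLeft (f : Series n) : Poly n →ₗ[ℂ] ℂ :=
  (basisMonomials (Fin n) ℂ).constr ℂ fun a => multiFactorial a * MvPowerSeries.coeff a f

theorem pairingLeft_monomial (f : Series n) (a : Fin n →₀ ℕ) (c : ℂ) :
    pairingLeft f (monomial a c) = c * (multiFactorial a * MvPowerSeries.coeff a f) := by
  have h : monomial a c = c • (basisMonomials (Fin n) ℂ a : Poly n) := by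
    simp [coe_basisMonomials, smul_monomial]
  rw [h, map_smul, pairingLeft, Module.Basis.constr_basis, smul_eq_mul]

/-- The left side is D^b p(D) f evaluated at 0. This turns statements about differential operators
into statements about the pairing. -/
theorem multiFactorial_mul_coeff_diffOp (p : Poly n) (b : Fin n →₀ ℕ) (f : Series n) :
    multiFactorial b * MvPowerSeries.coeff b (diffOp p f) =
      pairingLeft f (monomial b 1 * p) := by
  conv_rhs => rw [← support_sum_monomial_coeff p]
  rw [Finset.mul_sum, map_sum, diffOp, LinearMap.sum_apply, map_sum, Finset.mul_sum]
  refine Finset.sum_congr rfl fun a _ => ?_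
  rw [monomial_mul, pairingLeft_monomial, LinearMap.smul_apply, map_smul, smul_eq_mul,
    mul_left_comm, multiFactorial_mul_coeff_partialPow, one_mul, add_comm a b]

theorem pairing_eq_pairingLeft (p : Poly n) (f : Series n) : pairing p f = pairingLeft f p := by
  have h := multiFactorial_mul_coeff_diffOp p 0 f
  rw [multiFactorial_zero, one_mul] at h
  rw [pairing, LinearMap.comp_apply, h]
  congr 1
  exact one_mul p

theorem pairing_monomial (a : Fin n →₀ ℕ) (c : ℂ) (f : Series n) :
    pairing (monomial a c) f = c * (multiFactorial a * MvPowerSeries.coeff a f) := by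
  rw [pairing_eq_pairingLeft, pairingLeft_monomial]

theorem pairing_add_left (p q : Poly n) (f : Series n) :
    pairing (p + q) f = pairing p f + pairing q f := by
  simp only [pairing_eq_pairingLeft, map_add]

theorem pairing_smul_left (c : ℂ) (p : Poly n) (f : Series n) :
    pairing (c • p) f = c * pairing p f := by
  simp only [pairing_eq_pairingLeft, map_smul, smul_eq_mul]

theorem pairing_zero_left (f : Series n) : pairing (0 : Poly n) f = 0 := by
  simp only [pairing_eq_pairingLeft, map_zero]

theorem pairing_eq_sum (p : Poly n) (f : Series n) :
    pairing p f =
      ∑ a ∈ p.support, coeff a p * (multiFactorial a * MvPowerSeries.coeff a f) := by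
  conv_lhs => rw [← support_sum_monomial_coeff p]
  rw [pairing_eq_pairingLeft, map_sum]
  simp only [pairingLeft_monomial]

@[simp]
theorem coeff_toSeries (a : Fin n →₀ ℕ) (p : Poly n) :
    MvPowerSeries.coeff a (toSeries n p) = coeff a p :=
  coeff_coe p a

/-- The Taylor coefficients of p(D) f are, up to factorials, the pairings of f with the monomial
multiples of p. Hence kernels of operators are orthogonal complements of ideals. -/
theorem diffOp_eq_zero_iff (p : Poly n) (f : Series n) :
    diffOp p f = 0 ↔ ∀ q : Poly n, pairing (q * p) f = 0 := by
  constructor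
  · intro h q
    induction q using MvPolynomial.induction_on' with
    | monomial a c =>
      have := multiFactorial_mul_coeff_diffOp p a f
      rw [h, map_zero, mul_zero] at this
      have h2 : monomial a c * p = c • (monomial a 1 * p) := by
        rw [← smul_mul_assoc, smul_monomial, smul_eq_mul, mul_one]
      rw [h2, pairing_smul_left, pairing_eq_pairingLeft, ← this, mul_zero]
    | add p1 p2 h1 h2 => rw [add_mul, pairing_add_left, h1, h2, add_zero]
  · intro h
    ext a
    have h1 := multiFactorial_mul_coeff_diffOp p a f
    rw [← pairing_eq_pairingLeft, h] at h1
    rw [map_zero]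
    exact (mul_eq_zero.1 h1).resolve_left (multiFactorial_ne_zero a)

theorem pairing_toSeries_comm (p q : Poly n) :
    pairing p (toSeries n q) = pairing q (toSeries n p) := by
  classical
  induction p using MvPolynomial.induction_on' with
  | add p1 p2 h1 h2 => rw [pairing_add_left, h1, h2, map_add, map_add]
  | monomial a c =>
    induction q using MvPolynomial.induction_on' with
    | add p1 p2 h1 h2 => rw [pairing_add_left, ← h1, ← h2, map_add, map_add]
    | monomial b d =>
      rw [pairing_monomial, pairing_monomial, coeff_toSeries, coeff_toSeries, coeff_monomial,
        coeff_monomial]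
      by_cases h : a = b
      · subst h; simp; ring
      · simp [h, Ne.symm h]

theorem pairing_expSeries (p : Poly n) (α : Fin n → ℂ) :
    pairing p (expSeries α) = eval α p := by
  induction p using MvPolynomial.induction_on' with
  | add p1 p2 h1 h2 => rw [pairing_add_left, h1, h2, map_add]
  | monomial a c =>
    rw [pairing_monomial, eval_monomial, Finsupp.prod_fintype _ _ (by simp)]
    congr 1
    change (∏ i : Fin n, _) * (∏ i : Fin n, _) = _
    rw [← Finset.prod_mul_distrib]
    refine Finset.prod_congr rfl fun i _ => ?_
    rw [mul_div_cancel₀]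
    exact Nat.cast_ne_zero.2 (Nat.factorial_ne_zero _)

/-! ### Directional derivatives -/

/-- The derivative in the direction `η`. -/
noncomputable def dirDeriv (η : Fin n → ℝ) : Derivation ℂ (Poly n) (Poly n) :=
  mkDerivation ℂ fun i => C (η i : ℂ)

theorem dirDeriv_X (η : Fin n → ℝ) (i : Fin n) :
    dirDeriv η (X i : Poly n) = C (η i : ℂ) :=
  mkDerivation_X _ _ _

theorem dirDeriv_C (η : Fin n → ℝ) (c : ℂ) : dirDeriv η (C c : Poly n) = 0 :=
  Derivation.map_algebraMap _ c

theorem dirDeriv_eq_sum (η : Fin n → ℝ) (f : Poly n) :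
    dirDeriv η f = ∑ i, (η i : ℂ) • pderiv i f := by
  have hsum : ∀ g : Poly n, (∑ i, (η i : ℂ) • (pderiv i : Derivation ℂ (Poly n) (Poly n))) g =
      ∑ i, (η i : ℂ) • pderiv i g := by
    intro g
    have := congrFun (map_sum (Derivation.coeFnAddMonoidHom (R := ℂ) (A := Poly n) (M := Poly n))
      (fun i => (η i : ℂ) • (pderiv i : Derivation ℂ (Poly n) (Poly n))) Finset.univ) g
    rw [Finset.sum_apply] at this
    exact this
  have h : dirDeriv η = ∑ i, (η i : ℂ) • (pderiv i : Derivation ℂ (Poly n) (Poly n)) := by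
    classical
    refine MvPolynomial.derivation_ext fun j => ?_
    rw [dirDeriv_X, hsum]
    simp only [pderiv_X, Pi.single_apply]
    simp [Algebra.smul_def]
  rw [h, hsum]

theorem dirDeriv_linForm (η x : Fin n → ℝ) :
    dirDeriv η (linForm x) = C ((η ⬝ᵥ x : ℝ) : ℂ) := by
  rw [linForm, map_sum, dotProduct, Complex.ofReal_sum, map_sum]
  refine Finset.sum_congr rfl fun i _ => ?_
  rw [Derivation.leibniz, dirDeriv_C, dirDeriv_X, smul_zero, add_zero, smul_eq_mul, ← map_mul,
    Complex.ofReal_mul, mul_comm]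

/-- The Leibniz rule for iterated derivatives, when one factor has constant derivative. -/
theorem dirDeriv_iterate_mul (η : Fin n → ℝ) {l : Poly n} {c : ℂ}
    (hl : dirDeriv η l = C c) (f : Poly n) (k : ℕ) :
    (dirDeriv η)^[k] (l * f) =
      l * (dirDeriv η)^[k] f + (k * c : ℂ) • (dirDeriv η)^[k - 1] f := by
  induction k with
  | zero => simp
  | succ k ih =>
    rw [Function.iterate_succ_apply', ih, map_add, Derivation.leibniz, hl, Derivation.map_smul,
      ← Function.iterate_succ_apply' (dirDeriv η) k]
    rcases k with _ | k
    · simp [Algebra.smul_def, mul_comm]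
    · rw [← Function.iterate_succ_apply' (dirDeriv η) (k + 1 - 1)]
      simp only [Nat.add_sub_cancel, smul_eq_mul, Nat.succ_eq_add_one]
      simp only [Algebra.smul_def, MvPolynomial.algebraMap_eq]
      push_cast
      simp only [map_mul, map_add, map_one, map_natCast]
      ring

theorem exists_dirDeriv_iterate_eq_zero (η : Fin n → ℝ) (f : Poly n) :
    ∃ k, ∀ m ≥ k, (dirDeriv η)^[m] f = 0 := by
  suffices h : ∃ k, (dirDeriv η)^[k] f = 0 by
    obtain ⟨k, hk⟩ := h
    refine ⟨k, fun m hm => ?_⟩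
    obtain ⟨j, rfl⟩ := Nat.exists_eq_add_of_le' hm
    rw [Function.iterate_add_apply, hk]
    exact Function.iterate_fixed (map_zero _) j
  have mono : ∀ {g : Poly n} {k m : ℕ}, k ≤ m → (dirDeriv η)^[k] g = 0 →
      (dirDeriv η)^[m] g = 0 := by
    intro g k m hm hk
    obtain ⟨j, rfl⟩ := Nat.exists_eq_add_of_le' hm
    rw [Function.iterate_add_apply, hk]
    exact Function.iterate_fixed (map_zero _) j
  induction f using MvPolynomial.induction_on with
  | C c => exact ⟨1, dirDeriv_C η c⟩
  | add p q hp hq =>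
    obtain ⟨k, hk⟩ := hp
    obtain ⟨m, hm⟩ := hq
    refine ⟨max k m, ?_⟩
    rw [iterate_map_add, mono (le_max_left k m) hk, mono (le_max_right k m) hm, add_zero]
  | mul_X p i hp =>
    obtain ⟨k, hk⟩ := hp
    refine ⟨k + 1, ?_⟩
    rw [mul_comm, dirDeriv_iterate_mul η (dirDeriv_X η i), mono (Nat.le_succ k) hk,
      Nat.add_sub_cancel, hk, mul_zero, smul_zero, add_zero]

theorem pairing_X_mul (i : Fin n) (q f : Poly n) :
    pairing (X i * q) (toSeries n f) = pairing q (toSeries n (pderiv i f)) := by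
  induction q using MvPolynomial.induction_on' with
  | add p1 p2 h1 h2 => rw [mul_add, pairing_add_left, pairing_add_left, h1, h2]
  | monomial a c =>
    rw [X, monomial_mul, pairing_monomial, pairing_monomial, coeff_toSeries, coeff_toSeries,
      coeff_pderiv, add_comm (Finsupp.single i 1) a, multiFactorial_add_single]
    ring

theorem pairing_linForm_mul (η : Fin n → ℝ) (q f : Poly n) :
    pairing (linForm η * q) (toSeries n f) = pairing q (toSeries n (dirDeriv η f)) := by
  rw [linForm, Finset.sum_mul, dirDeriv_eq_sum, map_sum, map_sum, pairing_eq_pairingLeft, map_sum]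
  refine Finset.sum_congr rfl fun i _ => ?_
  rw [map_smul, map_smul, smul_eq_mul, ← pairing_X_mul, ← pairing_eq_pairingLeft, mul_assoc,
    C_mul', pairing_smul_left]

theorem pairing_mul_linForm_pow (η : Fin n → ℝ) (k : ℕ) (q f : Poly n) :
    pairing (q * linForm η ^ k) (toSeries n f) =
      pairing q (toSeries n ((dirDeriv η)^[k] f)) := by
  induction k generalizing f with
  | zero => simp
  | succ k ih =>
    rw [pow_succ, ← mul_assoc, mul_comm _ (linForm η), pairing_linForm_mul, ih,
      Function.iterate_succ_apply]

theorem eq_zero_of_pairing_toSeries {f : Poly n}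
    (h : ∀ q : Poly n, pairing q (toSeries n f) = 0) : f = 0 := by
  ext a
  have := h (monomial a 1)
  rw [pairing_monomial, one_mul, coeff_toSeries] at this
  simpa using (mul_eq_zero.1 this).resolve_left (multiFactorial_ne_zero a)

theorem dirDeriv_iterate_eq_zero_iff (η : Fin n → ℝ) (k : ℕ) (f : Poly n) :
    (dirDeriv η)^[k] f = 0 ↔ ∀ q, pairing (q * linForm η ^ k) (toSeries n f) = 0 := by
  simp only [pairing_mul_linForm_pow]
  exact ⟨fun h q => by rw [h, map_zero, map_zero], eq_zero_of_pairing_toSeries⟩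

/-! ### Orthogonal complements of ideals -/

/-- The polynomials that are orthogonal to an ideal. -/
noncomputable def idealPerp (I : Ideal (Poly n)) : Submodule ℂ (Poly n) where
  carrier := {f | ∀ q ∈ I, pairing q (toSeries n f) = 0}
  add_mem' hf hg q hq := by rw [map_add, map_add, hf q hq, hg q hq, add_zero]
  zero_mem' q _ := by rw [map_zero, map_zero]
  smul_mem' c f hf q hq := by rw [map_smul, map_smul, hf q hq, smul_zero]

theorem mem_idealPerp_span {S : Set (Poly n)} {f : Poly n} :
    f ∈ idealPerp (Ideal.span S) ↔ ∀ p ∈ S, ∀ q, pairing (q * p) (toSeries n f) = 0 := by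
  constructor
  · intro h p hp q
    exact h _ (Ideal.mul_mem_left _ _ (Ideal.subset_span hp))
  · intro h q hq
    refine Submodule.span_induction (p := fun q _ => ∀ r, pairing (r * q) (toSeries n f) = 0)
      h ?_ ?_ ?_ hq 1 |> fun h => by rwa [one_mul] at h
    · intro r; rw [mul_zero, pairing_zero_left]
    · intro x y _ _ hx hy r; rw [mul_add, pairing_add_left, hx, hy, add_zero]
    · intro a x _ hx r; rw [smul_eq_mul, ← mul_assoc]; exact hx _

theorem internalD_eq_idealPerp {ι : Type*} [LinearOrder ι] (X : ι → Fin n → ℝ) :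
    internalD X = idealPerp (internalJ X) := by
  ext f
  rw [internalJ, mem_idealPerp_span]
  constructor
  · rintro h _ ⟨Y, hY, rfl⟩
    exact (diffOp_eq_zero_iff _ _).1 (h Y hY)
  · intro h Y hY
    exact (diffOp_eq_zero_iff _ _).2 (h _ ⟨Y, hY, rfl⟩)

theorem mem_idealPerp_internalI {ι : Type*} {X : ι → Fin n → ℝ} {f : Poly n} :
    f ∈ idealPerp (internalI X) ↔ ∀ (H : Submodule ℝ (Fin n → ℝ)) (η : Fin n → ℝ),
      IsFacetHyperplane X H → η ≠ 0 → (∀ h ∈ H, η ⬝ᵥ h = 0) →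
        (dirDeriv η)^[facetMult X H - 1] f = 0 := by
  rw [internalI, mem_idealPerp_span]
  constructor
  · intro h H η hH hη hn
    exact (dirDeriv_iterate_eq_zero_iff _ _ _).2 (h _ ⟨H, η, hH, hη, hn, rfl⟩)
  · rintro h _ ⟨H, η, hH, hη, hn, rfl⟩
    exact (dirDeriv_iterate_eq_zero_iff _ _ _).1 (h H η hH hη hn)

/-- The kernel of an ideal with no zeros outside the origin consists of polynomials. -/
theorem map_idealPerp_eq_idealKer {S : Set (Poly n)}
    (hS : ∀ q ∈ S, eval 0 q = 0 ∨ q = 1)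
    (hvar : ∀ θ ∈ variety (Ideal.span S), θ = 0) :
    (idealPerp (Ideal.span S)).map (toSeries n) = idealKer (Ideal.span S) := by
  have hexp : expSeries (0 : Fin n → ℂ) = 1 := by
    ext a
    rw [MvPowerSeries.coeff_one]
    change (∏ i : Fin n, _) = _
    split_ifs with h
    · subst h; simp
    · obtain ⟨i, hi⟩ := Finsupp.ne_iff.1 h
      refine Finset.prod_eq_zero (Finset.mem_univ i) ?_
      rw [Pi.zero_apply, zero_pow hi, zero_div]
  apply le_antisymm
  · rintro _ ⟨p, hp, rfl⟩
    -- If the origin is not a zero, some generator is 1, the ideal is everything, and its complement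
    -- is zero.
    by_cases h0 : (0 : Fin n → ℂ) ∈ variety (Ideal.span S)
    · exact Submodule.subset_span ⟨0, h0, p, by rw [hexp, one_mul], hp⟩
    · have h1 : (1 : Poly n) ∈ Ideal.span S := by
        by_contra h1
        apply h0
        intro q hq
        have : Ideal.span S ≤ RingHom.ker (eval (0 : Fin n → ℂ)) := by
          refine Ideal.span_le.2 fun q hq => ?_
          rcases hS q hq with h | rfl
          · exact h
          · exact absurd (Ideal.subset_span hq) h1
        exact this hq
      have hp0 : p = 0 := eq_zero_of_pairing_toSeries fun q =>
        hp q (by simpa using Ideal.mul_mem_left _ q h1)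
      rw [hp0, map_zero]
      exact Submodule.zero_mem _
  · refine Submodule.span_le.2 ?_
    rintro g ⟨α, hα, p, rfl, h⟩
    obtain rfl := hvar α hα
    rw [hexp, one_mul] at h ⊢
    exact ⟨p, h, rfl⟩

end

/-! ### Linear and affine forms, and polynomials modulo those vanishing on a real flat -/

section

variable {n : ℕ}

/-! ### Linear forms -/

theorem linForm_add (x y : Fin n → ℝ) : linForm (x + y) = linForm x + linForm y := by
  simp only [linForm, Pi.add_apply, Complex.ofReal_add, map_add, add_mul, Finset.sum_add_distrib]

theorem linForm_smul (c : ℝ) (x : Fin n → ℝ) : linForm (c • x) = (c : ℂ) • linForm x := by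
  simp only [linForm, Pi.smul_apply, smul_eq_mul, Complex.ofReal_mul, map_mul, Finset.smul_sum,
    smul_eq_C_mul, mul_assoc]

theorem linForm_zero : linForm (0 : Fin n → ℝ) = 0 := by
  simp [linForm]

theorem linForm_sub (x y : Fin n → ℝ) : linForm (x - y) = linForm x - linForm y := by
  simp only [linForm, Pi.sub_apply, Complex.ofReal_sub, map_sub, sub_mul, Finset.sum_sub_distrib]

theorem linForm_sum {ι : Type*} (s : Finset ι) (f : ι → Fin n → ℝ) :
    linForm (∑ i ∈ s, f i) = ∑ i ∈ s, linForm (f i) := by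
  classical
  induction s using Finset.induction_on with
  | empty => simp [linForm_zero]
  | insert a s ha ih => rw [Finset.sum_insert ha, Finset.sum_insert ha, linForm_add, ih]

theorem linForm_single (i : Fin n) : linForm (Pi.single i 1) = (X i : Poly n) := by
  classical
  rw [linForm, Finset.sum_eq_single i]
  · simp
  · intro j _ hj; simp [Pi.single_eq_of_ne hj]
  · simp

/-- The inclusion `ℝⁿ → ℂⁿ`. -/
def complexPoint (t : Fin n → ℝ) : Fin n → ℂ := fun i => (t i : ℂ)

theorem eval_linForm (x t : Fin n → ℝ) :
    eval (complexPoint t) (linForm x) = ((x ⬝ᵥ t : ℝ) : ℂ) := by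
  simp [linForm, complexPoint, dotProduct]

theorem linForm_mem_span_of_mem_span {s : Set (Fin n → ℝ)} {x : Fin n → ℝ}
    (hx : x ∈ Submodule.span ℝ s) : linForm x ∈ Submodule.span ℂ (linForm '' s) := by
  induction hx using Submodule.span_induction with
  | mem x hx => exact Submodule.subset_span ⟨x, hx, rfl⟩
  | zero => rw [linForm_zero]; exact Submodule.zero_mem _
  | add x y _ _ hx hy => rw [linForm_add]; exact Submodule.add_mem _ hx hy
  | smul c x _ hx => rw [linForm_smul]; exact Submodule.smul_mem _ _ hx

/-- Along η the product has degree at most the number of its factors that are not constant in that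
direction. -/
theorem dirDeriv_iterate_prod_linForm_eq_zero {κ : Type*} (η : Fin n → ℝ) (q : κ → Fin n → ℝ)
    (Y : Finset κ) (k : ℕ) (h : (Y.filter fun y => η ⬝ᵥ q y ≠ 0).card < k) :
    (dirDeriv η)^[k] (∏ y ∈ Y, linForm (q y)) = 0 := by
  classical
  induction Y using Finset.induction_on generalizing k with
  | empty =>
    obtain ⟨k, rfl⟩ := Nat.exists_eq_succ_of_ne_zero (by omega : k ≠ 0)
    rw [Finset.prod_empty, Function.iterate_succ_apply, ← C_1, dirDeriv_C]
    exact Function.iterate_fixed (map_zero _) k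
  | insert a Y ha ih =>
    rw [Finset.prod_insert ha, dirDeriv_iterate_mul η (dirDeriv_linForm η (q a))]
    rw [Finset.filter_insert] at h
    split_ifs at h with h0
    · rw [Finset.card_insert_of_notMem (by simp [ha])] at h
      rw [ih k (by omega), ih (k - 1) (by omega), mul_zero, smul_zero, add_zero]
    · rw [ih k h, not_not.1 h0]
      simp

theorem exists_dotProduct_eq (f : (Fin n → ℝ) →ₗ[ℝ] ℝ) : ∃ u : Fin n → ℝ, ∀ x, f x = x ⬝ᵥ u := by
  classical
  refine ⟨fun i => f (Pi.single i 1), fun x => ?_⟩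
  rw [LinearMap.pi_apply_eq_sum_univ f x, dotProduct]
  refine Finset.sum_congr rfl fun i _ => ?_
  rw [smul_eq_mul]
  congr 2
  funext j
  simp [Pi.single_apply, eq_comm]

theorem exists_dotProduct_eq_one {W : Submodule ℝ (Fin n → ℝ)} {x : Fin n → ℝ} (hx : x ∉ W) :
    ∃ u : Fin n → ℝ, x ⬝ᵥ u = 1 ∧ ∀ w ∈ W, w ⬝ᵥ u = 0 := by
  obtain ⟨f, hf, hW⟩ := Submodule.exists_le_ker_of_notMem hx
  obtain ⟨u, hu⟩ := exists_dotProduct_eq ((f x)⁻¹ • f)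
  refine ⟨u, ?_, fun w hw => ?_⟩
  · rw [← hu, LinearMap.smul_apply, smul_eq_mul, inv_mul_cancel₀ hf]
  · rw [← hu, LinearMap.smul_apply, LinearMap.mem_ker.1 (hW hw), smul_zero]

/-! ### Polynomials that vanish on a set of real points -/

/-- The polynomials that vanish on the set `T` of real points. -/
noncomputable def realVanishingIdeal (T : Set (Fin n → ℝ)) : Ideal (Poly n) :=
  ⨅ t ∈ T, RingHom.ker (eval (complexPoint t))

theorem mem_realVanishingIdeal {T : Set (Fin n → ℝ)} {f : Poly n} :
    f ∈ realVanishingIdeal T ↔ ∀ t ∈ T, eval (complexPoint t) f = 0 := by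
  simp [realVanishingIdeal, Submodule.mem_iInf, RingHom.mem_ker]

theorem realVanishingIdeal_anti {S T : Set (Fin n → ℝ)} (h : S ⊆ T) :
    realVanishingIdeal T ≤ realVanishingIdeal S := fun _ hf =>
  mem_realVanishingIdeal.2 fun t ht => mem_realVanishingIdeal.1 hf t (h ht)

/-- The real points are Zariski dense in ℂⁿ. -/
theorem realVanishingIdeal_univ_eq_bot : realVanishingIdeal (Set.univ : Set (Fin n → ℝ)) = ⊥ := by
  refine (Submodule.eq_bot_iff _).2 fun f hf => ?_
  refine MvPolynomial.funext_set (fun _ : Fin n => Set.range ((↑) : ℝ → ℂ))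
    (fun _ => Set.infinite_range_of_injective Complex.ofReal_injective) ?_
  intro x hx
  rw [map_zero]
  choose t ht using fun i => hx i (Set.mem_univ i)
  have := mem_realVanishingIdeal.1 hf t (Set.mem_univ _)
  rwa [show complexPoint t = x from funext ht] at this

/-- The restriction of a polynomial to the line through `t` in the direction `u`. -/
noncomputable def lineHom (t u : Fin n → ℝ) : Poly n →ₐ[ℂ] Polynomial ℂ :=
  aeval fun i => Polynomial.C (t i : ℂ) + Polynomial.C (u i : ℂ) * Polynomial.X

theorem eval_lineHom (t u : Fin n → ℝ) (s : ℝ) (f : Poly n) :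
    (lineHom t u f).eval (s : ℂ) = eval (complexPoint (t + s • u)) f := by
  induction f using MvPolynomial.induction_on with
  | C c => rw [eval_C, ← algebraMap_eq, AlgHom.commutes]; simp
  | add p q hp hq => rw [map_add, map_add, Polynomial.eval_add, hp, hq]
  | mul_X p i hp =>
    rw [map_mul, map_mul, Polynomial.eval_mul, hp, lineHom, aeval_X, eval_X]
    congr 1
    simp only [complexPoint, Polynomial.eval_add, Polynomial.eval_C, Polynomial.eval_mul,
      Polynomial.eval_X, Pi.add_apply, Pi.smul_apply, smul_eq_mul, Complex.ofReal_add,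
      Complex.ofReal_mul]
    ring

theorem derivative_lineHom (t u : Fin n → ℝ) (f : Poly n) :
    Polynomial.derivative (lineHom t u f) = lineHom t u (dirDeriv u f) := by
  induction f using MvPolynomial.induction_on with
  | C c =>
    rw [dirDeriv_C, map_zero, ← algebraMap_eq, AlgHom.commutes, Polynomial.algebraMap_eq,
      Polynomial.derivative_C]
  | add p q hp hq => rw [map_add, map_add, map_add, map_add, hp, hq]
  | mul_X p i hp =>
    have h1 : lineHom t u (X i) =
        Polynomial.C (t i : ℂ) + Polynomial.C (u i : ℂ) * Polynomial.X := aeval_X _ _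
    have h2 : lineHom t u (C (u i : ℂ)) = Polynomial.C (u i : ℂ) := by
      rw [← algebraMap_eq, AlgHom.commutes, Polynomial.algebraMap_eq]
    rw [map_mul, Polynomial.derivative_mul, hp, Derivation.leibniz, dirDeriv_X, map_add,
      smul_eq_mul, smul_eq_mul, map_mul, map_mul, h1, h2]
    simp
    ring

theorem lineHom_eq_zero {T : Set (Fin n → ℝ)} {t u : Fin n → ℝ} (hT : ∀ s : ℝ, t + s • u ∈ T)
    {f : Poly n} (hf : f ∈ realVanishingIdeal T) : lineHom t u f = 0 := by
  refine Polynomial.eq_zero_of_infinite_isRoot _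
    ((Set.infinite_range_of_injective Complex.ofReal_injective).mono ?_)
  rintro _ ⟨s, rfl⟩
  rw [Set.mem_ofPred_eq, Polynomial.IsRoot, eval_lineHom]
  exact mem_realVanishingIdeal.1 hf _ (hT s)

theorem eval_eq_zero_of_lineHom_eq_zero {t u : Fin n → ℝ} {f : Poly n} (h : lineHom t u f = 0) :
    eval (complexPoint t) f = 0 := by
  have := eval_lineHom t u 0 f
  rw [h, zero_smul, add_zero, Polynomial.eval_zero] at this
  exact this.symm

theorem dirDeriv_mem_realVanishingIdeal {T : Set (Fin n → ℝ)} {u : Fin n → ℝ}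
    (hT : ∀ t ∈ T, ∀ s : ℝ, t + s • u ∈ T) {f : Poly n} (hf : f ∈ realVanishingIdeal T) :
    dirDeriv u f ∈ realVanishingIdeal T := by
  refine mem_realVanishingIdeal.2 fun t ht => eval_eq_zero_of_lineHom_eq_zero (u := u) ?_
  rw [← derivative_lineHom, lineHom_eq_zero (hT t ht) hf, map_zero]

theorem dirDeriv_iterate_mem_realVanishingIdeal {T : Set (Fin n → ℝ)} {u : Fin n → ℝ}
    (hT : ∀ t ∈ T, ∀ s : ℝ, t + s • u ∈ T) {f : Poly n} (hf : f ∈ realVanishingIdeal T) (k : ℕ) :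
    (dirDeriv u)^[k] f ∈ realVanishingIdeal T := by
  induction k with
  | zero => exact hf
  | succ k ih =>
    rw [Function.iterate_succ_apply']
    exact dirDeriv_mem_realVanishingIdeal hT ih

theorem dirDeriv_iterate_mem_of_le {T : Set (Fin n → ℝ)} {u : Fin n → ℝ}
    (hT : ∀ t ∈ T, ∀ s : ℝ, t + s • u ∈ T) {f : Poly n} {k m : ℕ} (hkm : k ≤ m)
    (hf : (dirDeriv u)^[k] f ∈ realVanishingIdeal T) :
    (dirDeriv u)^[m] f ∈ realVanishingIdeal T := by
  obtain ⟨j, rfl⟩ := Nat.exists_eq_add_of_le' hkm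
  rw [Function.iterate_add_apply]
  exact dirDeriv_iterate_mem_realVanishingIdeal hT hf j

/-- The affine form `t ↦ x · t - c`. -/
noncomputable def affForm (x : Fin n → ℝ) (c : ℝ) : Poly n := linForm x - C (c : ℂ)

theorem eval_affForm (x : Fin n → ℝ) (c : ℝ) (t : Fin n → ℝ) :
    eval (complexPoint t) (affForm x c) = ((x ⬝ᵥ t - c : ℝ) : ℂ) := by
  rw [affForm, map_sub, eval_linForm, eval_C, Complex.ofReal_sub]

theorem affForm_zero (x : Fin n → ℝ) : affForm x 0 = linForm x := by
  simp [affForm]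

theorem dirDeriv_affForm (η x : Fin n → ℝ) (c : ℝ) :
    dirDeriv η (affForm x c) = C ((η ⬝ᵥ x : ℝ) : ℂ) := by
  rw [affForm, map_sub, dirDeriv_linForm, dirDeriv_C, sub_zero]

/-- On every line in the direction u the affine form has slope 1, so it restricts to a nonzero
polynomial and can be cancelled in the domain ℂ[s]. -/
theorem mem_realVanishingIdeal_of_affForm_mul_mem {T : Set (Fin n → ℝ)} {x u : Fin n → ℝ}
    (c : ℝ) (hxu : x ⬝ᵥ u = 1) (hT : ∀ t ∈ T, ∀ s : ℝ, t + s • u ∈ T) {g : Poly n}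
    (hg : affForm x c * g ∈ realVanishingIdeal T) : g ∈ realVanishingIdeal T := by
  refine mem_realVanishingIdeal.2 fun t ht => eval_eq_zero_of_lineHom_eq_zero (u := u) ?_
  have h := lineHom_eq_zero (hT t ht) hg
  rw [map_mul] at h
  refine (mul_eq_zero.1 h).resolve_left fun h0 => ?_
  have h1 : Polynomial.derivative (lineHom t u (affForm x c)) = 1 := by
    rw [derivative_lineHom, dirDeriv_affForm, dotProduct_comm, hxu, Complex.ofReal_one, C_1,
      map_one]
  rw [h0, map_zero] at h1
  exact zero_ne_one h1

/-- Division by the affine form: the substitution `φ` projects along u onto the hyperplane x·t = c.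
It alters a polynomial by a multiple of the form, and sends f to a polynomial vanishing on T. -/
theorem exists_sub_affForm_mul_mem {T : Set (Fin n → ℝ)} {x u : Fin n → ℝ}
    (c : ℝ) (hxu : x ⬝ᵥ u = 1) (hT : ∀ t ∈ T, ∀ s : ℝ, t + s • u ∈ T) {f : Poly n}
    (hf : f ∈ realVanishingIdeal (T ∩ {t | x ⬝ᵥ t = c})) :
    ∃ h, f - affForm x c * h ∈ realVanishingIdeal T := by
  set φ : Poly n →ₐ[ℂ] Poly n := aeval fun i => X i - C (u i : ℂ) * affForm x c with hφ
  have hdvd : ∀ p : Poly n, affForm x c ∣ p - φ p := by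
    intro p
    induction p using MvPolynomial.induction_on with
    | C a => rw [← algebraMap_eq, AlgHom.commutes, sub_self]; exact dvd_zero _
    | add p q hp hq =>
      rw [map_add, add_sub_add_comm]
      exact dvd_add hp hq
    | mul_X p i hp =>
      have : p * X i - φ (p * X i) = (p - φ p) * X i + affForm x c * (C (u i : ℂ) * φ p) := by
        rw [map_mul, show φ (X i) = X i - C (u i : ℂ) * affForm x c from aeval_X _ _]
        ring
      rw [this]
      exact dvd_add (hp.mul_right _) (dvd_mul_right _ _)
  have heval : ∀ (t : Fin n → ℝ) (p : Poly n), eval (complexPoint t) (φ p) =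
      eval (complexPoint (t + (-(x ⬝ᵥ t - c)) • u)) p := by
    intro t p
    induction p using MvPolynomial.induction_on with
    | C a => rw [← algebraMap_eq, AlgHom.commutes]; simp
    | add p q hp hq => rw [map_add, map_add, map_add, hp, hq]
    | mul_X p i hp =>
      rw [map_mul, map_mul, map_mul, hp, show φ (X i) = X i - C (u i : ℂ) * affForm x c from
        aeval_X _ _, map_sub, map_mul, eval_affForm]
      simp [complexPoint]
      left
      ring
  obtain ⟨h, hh⟩ := hdvd f
  refine ⟨h, mem_realVanishingIdeal.2 fun t ht => ?_⟩
  rw [← hh, sub_sub_cancel, heval]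
  refine mem_realVanishingIdeal.1 hf _ ⟨hT t ht _, ?_⟩
  rw [Set.mem_ofPred_eq, dotProduct_add, dotProduct_smul, hxu, smul_eq_mul]
  ring

/-- Write ℓ for the affine form, ∂ for the derivative along η and a = η·x ≠ 0, so that ∂^k(ℓg) = ℓ
∂^k g + k a ∂^{k-1} g. Take the least k with ∂^k g zero on T. If k ≥ m, the left side and the first
term vanish on T, hence so does ∂^{k-1} g, against minimality; 1 ≤ m keeps k positive. -/
theorem dirDeriv_iterate_pred_mem_of_affForm_mul {T : Set (Fin n → ℝ)} {x η : Fin n → ℝ}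
    (c : ℝ) (hx : η ⬝ᵥ x ≠ 0) (hT : ∀ t ∈ T, ∀ s : ℝ, t + s • η ∈ T) {g : Poly n} {m : ℕ}
    (hm : 1 ≤ m) (hg : (dirDeriv η)^[m] (affForm x c * g) ∈ realVanishingIdeal T) :
    (dirDeriv η)^[m - 1] g ∈ realVanishingIdeal T := by
  classical
  have hex : ∃ k, (dirDeriv η)^[k] g ∈ realVanishingIdeal T := by
    obtain ⟨k, hk⟩ := exists_dirDeriv_iterate_eq_zero η g
    exact ⟨k, by rw [hk k le_rfl]; exact zero_mem _⟩
  by_cases hk : Nat.find hex ≤ m - 1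
  · exact dirDeriv_iterate_mem_of_le hT hk (Nat.find_spec hex)
  · exfalso
    set k := Nat.find hex with hkdef
    have h1 := dirDeriv_iterate_mem_of_le hT (by omega : m ≤ k) hg
    rw [dirDeriv_iterate_mul η (dirDeriv_affForm η x c)] at h1
    have h2 := (Ideal.add_mem_iff_right _ (Ideal.mul_mem_left _ _ (Nat.find_spec hex))).1 h1
    rw [smul_eq_C_mul] at h2
    have hc : ((k : ℂ) * ((η ⬝ᵥ x : ℝ) : ℂ)) ≠ 0 :=
      mul_ne_zero (Nat.cast_ne_zero.2 (by omega)) (Complex.ofReal_ne_zero.2 hx)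
    have h3 := Ideal.mul_mem_left _ (C ((k : ℂ) * ((η ⬝ᵥ x : ℝ) : ℂ))⁻¹) h2
    rw [← mul_assoc, ← map_mul, inv_mul_cancel₀ hc, C_1, one_mul] at h3
    exact Nat.find_min hex (by omega : k - 1 < Nat.find hex) h3

end

/-! ### Deletion and contraction for facet conditions, and the central space -/

section

variable {n : ℕ}

/-! ### Hyperplanes and normals -/

theorem exists_normal {H : Submodule ℝ (Fin n → ℝ)} (hH : H ≠ ⊤) :
    ∃ η : Fin n → ℝ, η ≠ 0 ∧ ∀ h ∈ H, η ⬝ᵥ h = 0 := by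
  obtain ⟨x, -, hx⟩ := SetLike.exists_of_lt (lt_top_iff_ne_top.2 hH)
  obtain ⟨u, hu, hW⟩ := exists_dotProduct_eq_one hx
  refine ⟨u, ?_, fun h hh => by rw [dotProduct_comm, hW h hh]⟩
  rintro rfl
  simp at hu

theorem eq_zero_of_forall_dotProduct {η : Fin n → ℝ} {s : Set (Fin n → ℝ)}
    (hs : Submodule.span ℝ s = ⊤) (h : ∀ x ∈ s, η ⬝ᵥ x = 0) : η = 0 := by
  have key : ∀ x ∈ Submodule.span ℝ s, η ⬝ᵥ x = 0 := by
    intro x hx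
    induction hx using Submodule.span_induction with
    | mem x hx => exact h x hx
    | zero => exact dotProduct_zero _
    | add x y _ _ hx hy => rw [dotProduct_add, hx, hy, add_zero]
    | smul c x _ hx => rw [dotProduct_smul, hx, smul_zero]
  exact dotProduct_self_eq_zero.1 (key η (hs ▸ Submodule.mem_top))

theorem dotProduct_ne_zero_of_notMem {H : Submodule ℝ (Fin n → ℝ)}
    (hH : Module.finrank ℝ H + 1 = n) {η : Fin n → ℝ} (hη : η ≠ 0) (hn : ∀ h ∈ H, η ⬝ᵥ h = 0)
    {x : Fin n → ℝ} (hx : x ∉ H) : η ⬝ᵥ x ≠ 0 := by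
  intro h0
  apply hη
  have hlt : H < H ⊔ Submodule.span ℝ {x} := by
    refine lt_of_le_of_ne le_sup_left fun h => hx ?_
    rw [h]
    exact Submodule.mem_sup_right (Submodule.mem_span_singleton_self x)
  have h1 := Submodule.finrank_lt_finrank_of_lt hlt
  have h2 : H ⊔ Submodule.span ℝ {x} = ⊤ := by
    apply Submodule.eq_top_of_finrank_eq
    have := Submodule.finrank_le (H ⊔ Submodule.span ℝ {x})
    rw [Module.finrank_fin_fun] at *
    omega
  rw [← Submodule.span_eq H, ← Submodule.span_union] at h2
  refine eq_zero_of_forall_dotProduct h2 ?_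
  rintro y (hy | rfl)
  exacts [hn y hy, h0]

theorem finrank_add_one_eq {H : Submodule ℝ (Fin n → ℝ)} (hH : H ≠ ⊤) {x : Fin n → ℝ}
    (hx : H ⊔ Submodule.span ℝ {x} = ⊤) : Module.finrank ℝ H + 1 = n := by
  have h1 := Submodule.finrank_lt hH
  have h2 := Submodule.finrank_add_le_finrank_add_finrank H (Submodule.span ℝ {x})
  have h3 : Module.finrank ℝ (Submodule.span ℝ {x}) ≤ 1 := by
    simpa using finrank_span_le_card (R := ℝ) ({x} : Set (Fin n → ℝ))
  rw [hx, finrank_top] at h2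
  rw [Module.finrank_fin_fun] at *
  omega

/-! ### Contracted configurations -/

variable {ι : Type*}

/-- The linear span of the vectors with index in `A`. -/
abbrev vecSpan (X : ι → Fin n → ℝ) (A : Finset ι) : Submodule ℝ (Fin n → ℝ) :=
  Submodule.span ℝ (X '' (A : Set ι))

theorem mem_vecSpan {X : ι → Fin n → ℝ} {A : Finset ι} {i : ι} (hi : i ∈ A) :
    X i ∈ vecSpan X A :=
  Submodule.subset_span ⟨i, hi, rfl⟩

theorem vecSpan_mono (X : ι → Fin n → ℝ) {A B : Finset ι} (h : A ⊆ B) :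
    vecSpan X A ≤ vecSpan X B :=
  Submodule.span_mono (Set.image_mono (Finset.coe_subset.2 h))

theorem vecSpan_le {X : ι → Fin n → ℝ} {A : Finset ι} {H : Submodule ℝ (Fin n → ℝ)} :
    vecSpan X A ≤ H ↔ ∀ i ∈ A, X i ∈ H := by
  rw [Submodule.span_le, Set.image_subset_iff]
  rfl

theorem vecSpan_insert [DecidableEq ι] (X : ι → Fin n → ℝ) (A : Finset ι) (i : ι) :
    vecSpan X (insert i A) = vecSpan X A ⊔ Submodule.span ℝ {X i} := by
  rw [vecSpan, Finset.coe_insert, Set.image_insert_eq, Submodule.span_insert, sup_comm]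

/-- The common points of the hyperplanes `x · t = λ_x` with index in `Z`. -/
def affFlat (X : ι → Fin n → ℝ) (lam : ι → ℝ) (Z : Finset ι) : Set (Fin n → ℝ) :=
  {t | ∀ i ∈ Z, X i ⬝ᵥ t = lam i}

theorem add_smul_mem_affFlat {X : ι → Fin n → ℝ} {lam : ι → ℝ} {Z : Finset ι}
    {u : Fin n → ℝ} (hu : ∀ w ∈ vecSpan X Z, w ⬝ᵥ u = 0) :
    ∀ t ∈ affFlat X lam Z, ∀ s : ℝ, t + s • u ∈ affFlat X lam Z := by
  intro t ht s i hi
  rw [dotProduct_add, dotProduct_smul, hu _ (mem_vecSpan hi), smul_zero, add_zero]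
  exact ht i hi

theorem affFlat_insert [DecidableEq ι] (X : ι → Fin n → ℝ) (lam : ι → ℝ) (Z : Finset ι) (i : ι) :
    affFlat X lam (insert i Z) = affFlat X lam Z ∩ {t | X i ⬝ᵥ t = lam i} := by
  ext t
  simp [affFlat, and_comm]

variable [DecidableEq ι]

open scoped Classical in
/-- `f` restricted to the flat of `Z` is annihilated by the powers with exponent `m(H) - e` of the
derivatives in the normal directions of the facet hyperplanes `H` of `A ∪ Z` that contain `Z`. -/
def FacetKilled (X : ι → Fin n → ℝ) (lam : ι → ℝ) (e : ℕ) (A Z : Finset ι) (f : Poly n) : Prop :=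
  ∀ (H : Submodule ℝ (Fin n → ℝ)) (η : Fin n → ℝ), Module.finrank ℝ H + 1 = n →
    vecSpan X Z ≤ H → H ≤ Submodule.span ℝ (X '' {i | i ∈ A ∪ Z ∧ X i ∈ H}) →
    η ≠ 0 → (∀ h ∈ H, η ⬝ᵥ h = 0) →
    (dirDeriv η)^[(A.filter fun i => X i ∉ H).card - e] f ∈
      realVanishingIdeal (affFlat X lam Z)

variable {X : ι → Fin n → ℝ} {lam : ι → ℝ} {e : ℕ} {A Z : Finset ι} {f g : Poly n} {x : ι}

theorem FacetKilled.sub (hf : FacetKilled X lam e A Z f) (hg : FacetKilled X lam e A Z g) :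
    FacetKilled X lam e A Z (f - g) := by
  intro H η h1 h2 h3 h4 h5
  rw [iterate_map_sub]
  exact sub_mem (hf H η h1 h2 h3 h4 h5) (hg H η h1 h2 h3 h4 h5)

theorem facetKilled_of_mem (e : ℕ) (A : Finset ι)
    (hf : f ∈ realVanishingIdeal (affFlat X lam Z)) :
    FacetKilled X lam e A Z f := by
  intro H η _ h2 _ _ h5
  refine dirDeriv_iterate_mem_realVanishingIdeal (add_smul_mem_affFlat fun w hw => ?_) hf _
  rw [dotProduct_comm]
  exact h5 w (h2 hw)

theorem filter_notMem_insert_of_mem {H : Submodule ℝ (Fin n → ℝ)} [DecidablePred fun i => X i ∉ H]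
    (hx : X x ∈ H) : ((insert x A).filter fun i => X i ∉ H) = A.filter fun i => X i ∉ H := by
  rw [Finset.filter_insert, if_neg (not_not.2 hx)]

theorem FacetKilled.of_mem_vecSpan (hx : X x ∈ vecSpan X Z)
    (hf : FacetKilled X lam e (insert x A) Z f) : FacetKilled X lam e A Z f := by
  classical
  intro H η h1 h2 h3 h4 h5
  have := hf H η h1 h2 (h3.trans (Submodule.span_mono (Set.image_mono ?_))) h4 h5
  · rwa [filter_notMem_insert_of_mem (h2 hx)] at this
  · rintro i ⟨hi, hiH⟩
    exact ⟨Finset.union_subset_union (Finset.subset_insert _ _) subset_rfl hi, hiH⟩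

/-- A hyperplane through x has the same multiplicity before and after contraction, and vanishing on
a flat passes to the smaller flat. -/
theorem FacetKilled.contract (hf : FacetKilled X lam e (insert x A) Z f) :
    FacetKilled X lam e A (insert x Z) f := by
  classical
  intro H η h1 h2 h3 h4 h5
  have hx : X x ∈ H := h2 (mem_vecSpan (Finset.mem_insert_self x Z))
  have := hf H η h1 ((vecSpan_mono X (Finset.subset_insert x Z)).trans h2) ?_ h4 h5
  · rw [filter_notMem_insert_of_mem hx] at this
    exact realVanishingIdeal_anti (by rw [affFlat_insert]; exact Set.inter_subset_left) this
  · rwa [Finset.insert_union, ← Finset.union_insert]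

theorem exists_notMem_of_span_eq_top {H : Submodule ℝ (Fin n → ℝ)}
    (hH : Module.finrank ℝ H + 1 = n) (hspan : vecSpan X (A ∪ Z) = ⊤) (hZ : vecSpan X Z ≤ H) :
    ∃ i ∈ A, X i ∉ H := by
  by_contra! h
  have : vecSpan X (A ∪ Z) ≤ H := vecSpan_le.2 fun i hi => by
    rcases Finset.mem_union.1 hi with hi | hi
    exacts [h i hi, hZ (mem_vecSpan hi)]
  rw [hspan, top_le_iff] at this
  rw [this, finrank_top, Module.finrank_fin_fun] at hH
  omega

/-- If x lies in H, the affine form is constant along the normal and can be cancelled. If not,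
deleting x lowers m(H) by one, which matches the one derivative spent on the affine form. -/
theorem FacetKilled.delete (hxA : x ∉ A) (hx : X x ∉ vecSpan X Z)
    (he : e = 0 ∨ e = 1 ∧ vecSpan X (A ∪ Z) = ⊤)
    (hf : FacetKilled X lam e (insert x A) Z (affForm (X x) (lam x) * g)) :
    FacetKilled X lam e A Z g := by
  classical
  intro H η h1 h2 h3 h4 h5
  have := hf H η h1 h2 (h3.trans (Submodule.span_mono (Set.image_mono ?_))) h4 h5
  swap
  · rintro i ⟨hi, hiH⟩
    exact ⟨Finset.union_subset_union (Finset.subset_insert _ _) subset_rfl hi, hiH⟩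
  by_cases hxH : X x ∈ H
  · rw [filter_notMem_insert_of_mem hxH, dirDeriv_iterate_mul η (dirDeriv_affForm _ _ _),
      h5 _ hxH, Complex.ofReal_zero, mul_zero, zero_smul, add_zero] at this
    obtain ⟨u, hu, hW⟩ := exists_dotProduct_eq_one hx
    exact mem_realVanishingIdeal_of_affForm_mul_mem _ hu (add_smul_mem_affFlat hW) this
  · rw [Finset.filter_insert, if_pos hxH, Finset.card_insert_of_notMem (by simp [hxA])] at this
    -- The exponent before deletion must be positive for a derivative to be spent. When e = 1 this
    -- needs a vector of A outside H, which the spanning hypothesis provides.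
    have hpos : e < (A.filter fun i => X i ∉ H).card + 1 := by
      rcases he with rfl | ⟨rfl, hs⟩
      · omega
      · obtain ⟨i, hi, hiH⟩ := exists_notMem_of_span_eq_top h1 hs h2
        have : 0 < (A.filter fun i => X i ∉ H).card :=
          Finset.card_pos.2 ⟨i, Finset.mem_filter.2 ⟨hi, hiH⟩⟩
        omega
    have h6 := dirDeriv_iterate_pred_mem_of_affForm_mul (lam x)
      (dotProduct_ne_zero_of_notMem h1 h4 h5 hxH) (add_smul_mem_affFlat fun w hw => by
        rw [dotProduct_comm]; exact h5 w (h2 hw)) (by omega) this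
    rwa [show (A.filter fun i => X i ∉ H).card + 1 - e - 1 =
      (A.filter fun i => X i ∉ H).card - e by omega] at h6

/-- If `x` is a coloop of `A ∪ Z`, then the hyperplane spanned by the other vectors is a facet with
multiplicity one. -/
theorem FacetKilled.of_coloop (hspan : vecSpan X (insert x A ∪ Z) = ⊤)
    (hns : vecSpan X (A ∪ Z) ≠ ⊤) (hf : FacetKilled X lam e (insert x A) Z f) :
    ∃ η : Fin n → ℝ, η ⬝ᵥ X x ≠ 0 ∧ (∀ w ∈ vecSpan X Z, η ⬝ᵥ w = 0) ∧
      (dirDeriv η)^[1 - e] f ∈ realVanishingIdeal (affFlat X lam Z) := by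
  classical
  obtain ⟨η, hη, hn⟩ := exists_normal hns
  rw [Finset.insert_union, vecSpan_insert] at hspan
  have h1 := finrank_add_one_eq hns hspan
  have h2 : vecSpan X Z ≤ vecSpan X (A ∪ Z) := vecSpan_mono X Finset.subset_union_right
  have hxH : X x ∉ vecSpan X (A ∪ Z) := by
    intro hx
    rw [sup_eq_left.2 ((Submodule.span_singleton_le_iff_mem _ _).2 hx)] at hspan
    exact hns hspan
  refine ⟨η, dotProduct_ne_zero_of_notMem h1 hη hn hxH, fun w hw => hn w (h2 hw), ?_⟩
  have := hf _ η h1 h2 (Submodule.span_mono (Set.image_mono fun i hi => ?_)) hη hn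
  · rw [Finset.filter_insert, if_pos hxH, Finset.filter_false_of_mem] at this
    · exact this
    · exact fun i hi => not_not.2 (mem_vecSpan (Finset.mem_union_left _ hi))
  · exact ⟨Finset.union_subset_union (Finset.subset_insert _ _) subset_rfl hi,
      mem_vecSpan (Finset.mem_coe.1 hi)⟩

/-! ### The central space -/

/-- The central space of the configuration `A`, contracted by `Z`. -/
noncomputable def relCentralP (X : ι → Fin n → ℝ) (A Z : Finset ι) : Submodule ℂ (Poly n) :=
  Submodule.span ℂ {p | ∃ Y ⊆ A, vecSpan X (A \ Y ∪ Z) = ⊤ ∧ p = prodForm X Y}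

theorem relCentralP_empty_right (X : ι → Fin n → ℝ) (A : Finset ι) :
    relCentralP X A ∅ = centralP X A := by
  simp only [relCentralP, centralP, Finset.union_empty, vecSpan]

theorem relCentralP_mono_insert : relCentralP X A Z ≤ relCentralP X (insert x A) Z := by
  refine Submodule.span_mono ?_
  rintro _ ⟨Y, hY, hs, rfl⟩
  refine ⟨Y, hY.trans (Finset.subset_insert _ _), ?_, rfl⟩
  rw [eq_top_iff, ← hs]
  exact vecSpan_mono X (Finset.union_subset_union
    (Finset.sdiff_subset_sdiff (Finset.subset_insert _ _) subset_rfl) subset_rfl)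

theorem relCentralP_contract_le (hxA : x ∉ A) :
    relCentralP X A (insert x Z) ≤ relCentralP X (insert x A) Z := by
  refine Submodule.span_mono ?_
  rintro _ ⟨Y, hY, hs, rfl⟩
  refine ⟨Y, hY.trans (Finset.subset_insert _ _), ?_, rfl⟩
  rwa [Finset.insert_sdiff_of_notMem _ (fun h => hxA (hY h)), Finset.insert_union,
    ← Finset.union_insert]

theorem linForm_mul_mem_relCentralP (hxA : x ∉ A) (hf : f ∈ relCentralP X A Z) :
    linForm (X x) * f ∈ relCentralP X (insert x A) Z := by
  induction hf using Submodule.span_induction with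
  | zero => rw [mul_zero]; exact zero_mem _
  | add p q _ _ hp hq => rw [mul_add]; exact add_mem hp hq
  | smul c p _ hp => rw [mul_smul_comm]; exact Submodule.smul_mem _ _ hp
  | mem p hp =>
    obtain ⟨Y, hY, hs, rfl⟩ := hp
    refine Submodule.subset_span ⟨insert x Y, Finset.insert_subset_insert x hY, ?_, ?_⟩
    · rwa [Finset.insert_sdiff_insert, Finset.sdiff_insert_of_notMem hxA]
    · rw [prodForm, prodForm, Finset.prod_insert fun h => hxA (hY h)]

-- The complement of a short set Y spans together with Z, so it contains a vector outside H; thus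
-- p_Y has fewer than m(H) factors that vary along the normal.
open scoped Classical in
theorem dirDeriv_iterate_eq_zero_of_mem_relCentralP {H : Submodule ℝ (Fin n → ℝ)}
    {η : Fin n → ℝ} (h1 : Module.finrank ℝ H + 1 = n) (h2 : vecSpan X Z ≤ H)
    (h5 : ∀ h ∈ H, η ⬝ᵥ h = 0) (hf : f ∈ relCentralP X A Z) :
    (dirDeriv η)^[(A.filter fun i => X i ∉ H).card] f = 0 := by
  induction hf using Submodule.span_induction with
  | zero => exact Function.iterate_fixed (map_zero _) _
  | add p q _ _ hp hq => rw [iterate_map_add, hp, hq, add_zero]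
  | smul c p _ hp =>
    have : ∀ k, (dirDeriv η)^[k] (c • p) = c • (dirDeriv η)^[k] p := by
      intro k
      induction k with
      | zero => rfl
      | succ k ih => rw [Function.iterate_succ_apply', ih, Derivation.map_smul,
          ← Function.iterate_succ_apply' (dirDeriv η)]
    rw [this, hp, smul_zero]
  | mem p hp =>
    obtain ⟨Y, hY, hs, rfl⟩ := hp
    refine dirDeriv_iterate_prod_linForm_eq_zero _ _ _ _ (Finset.card_lt_card ?_)
    obtain ⟨i, hi, hiH⟩ := exists_notMem_of_span_eq_top h1 hs h2
    rw [Finset.mem_sdiff] at hi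
    refine Finset.ssubset_iff_subset_ne.2 ⟨fun j hj => ?_, fun h => ?_⟩
    · rw [Finset.mem_filter] at hj ⊢
      exact ⟨hY hj.1, fun hjH => hj.2 (h5 _ hjH)⟩
    · exact hi.2 (Finset.mem_filter.1 (h ▸ Finset.mem_filter.2 ⟨hi.1, hiH⟩)).1

theorem facetKilled_of_mem_relCentralP (hf : f ∈ relCentralP X A Z) :
    FacetKilled X lam 0 A Z f := by
  intro H η h1 h2 _ _ h5
  rw [Nat.sub_zero, dirDeriv_iterate_eq_zero_of_mem_relCentralP h1 h2 h5 hf]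
  exact zero_mem _

/-- This is the converse: the facet conditions with exponent m(H) characterise the central space. In
the contraction by x one matches f on the smaller flat; the remainder is a multiple of the form of
x, whose cofactor is handled in the deletion of x. -/
theorem exists_mem_relCentralP_sub_mem (hspan : vecSpan X (A ∪ Z) = ⊤)
    (hf : FacetKilled X 0 0 A Z f) :
    ∃ g ∈ relCentralP X A Z, f - g ∈ realVanishingIdeal (affFlat X 0 Z) := by
  induction A using Finset.induction_on generalizing Z f with
  | empty =>
    rw [Finset.empty_union] at hspan
    refine ⟨C (eval 0 f), ?_, mem_realVanishingIdeal.2 fun t ht => ?_⟩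
    · rw [← mul_one (C _), ← smul_eq_C_mul]
      exact Submodule.smul_mem _ _ (Submodule.subset_span ⟨∅, subset_rfl, by simpa using hspan,
        by simp [prodForm]⟩)
    · have h0 : t = 0 := by
        refine eq_zero_of_forall_dotProduct hspan ?_
        rintro _ ⟨i, hi, rfl⟩
        rw [dotProduct_comm]
        exact ht i hi
      have h1 : complexPoint (0 : Fin n → ℝ) = 0 := by ext; simp [complexPoint]
      rw [h0, h1, map_sub, eval_C, sub_self]
  | insert x A hxA ih =>
    by_cases hx : X x ∈ vecSpan X Z
    · have hs : vecSpan X (A ∪ Z) = ⊤ := by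
        rw [eq_top_iff, ← hspan, Finset.insert_union, vecSpan_insert]
        exact sup_le le_rfl ((Submodule.span_singleton_le_iff_mem _ _).2
          (vecSpan_mono X Finset.subset_union_right hx))
      obtain ⟨g, hg, hfg⟩ := ih hs (hf.of_mem_vecSpan hx)
      exact ⟨g, relCentralP_mono_insert hg, hfg⟩
    · obtain ⟨g, hg, hfg⟩ := ih (Z := insert x Z) (f := f)
        (by rwa [Finset.union_insert, ← Finset.insert_union]) hf.contract
      have hg' := relCentralP_contract_le hxA hg
      obtain ⟨u, hu, hW⟩ := exists_dotProduct_eq_one hx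
      have hT := add_smul_mem_affFlat (lam := 0) hW
      rw [affFlat_insert] at hfg
      obtain ⟨h, hh⟩ := exists_sub_affForm_mul_mem _ hu hT hfg
      -- The product equals f - g up to a polynomial vanishing on the flat, and f, g both satisfy
      -- the facet conditions.
      have hk : FacetKilled X 0 0 (insert x A) Z (affForm (X x) ((0 : ι → ℝ) x) * h) := by
        have := (hf.sub (facetKilled_of_mem_relCentralP hg')).sub
          (facetKilled_of_mem 0 (insert x A) hh)
        rwa [sub_sub_cancel] at this
      by_cases hs : vecSpan X (A ∪ Z) = ⊤
      · obtain ⟨k, hk, hhk⟩ := ih hs (hk.delete hxA hx (Or.inl rfl))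
        refine ⟨g + linForm (X x) * k,
          Submodule.add_mem _ hg' (linForm_mul_mem_relCentralP hxA hk), ?_⟩
        have := Ideal.add_mem _ hh (Ideal.mul_mem_left _ (affForm (X x) ((0 : ι → ℝ) x)) hhk)
        rw [Pi.zero_apply, affForm_zero] at this
        convert this using 1
        ring
      -- For a coloop the first normal derivative of the product vanishes on the flat, so the
      -- cofactor itself does, and g needs no correction.
      · obtain ⟨η, hηx, hηZ, hmem⟩ := hk.of_coloop hspan hs
        have hh0 := dirDeriv_iterate_pred_mem_of_affForm_mul _ hηx
          (add_smul_mem_affFlat fun w hw => by rw [dotProduct_comm]; exact hηZ w hw) le_rfl hmem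
        refine ⟨g, hg', ?_⟩
        have := Ideal.add_mem _ hh (Ideal.mul_mem_left _ (affForm (X x) ((0 : ι → ℝ) x)) hh0)
        rwa [Nat.sub_self, Function.iterate_zero_apply, sub_add_cancel] at this

end

/-! ### The internal space as 𝓘₋^⊥, and uniqueness of interpolation at internal vertices -/

section

variable {n : ℕ} {ι : Type*}

/-- Deleting one vector lowers each m(H) by at most one, so the internal condition on X (e = 1)
yields the central condition on X \ x (e = 0). -/
theorem FacetKilled.weaken [DecidableEq ι] {X : ι → Fin n → ℝ} {lam : ι → ℝ} {e : ℕ}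
    {A Z : Finset ι} {f : Poly n} {x : ι}
    (hf : FacetKilled X lam (e + 1) (insert x A) Z f) : FacetKilled X lam e A Z f := by
  classical
  intro H η h1 h2 h3 h4 h5
  refine dirDeriv_iterate_mem_of_le (add_smul_mem_affFlat fun w hw => ?_) ?_
    (hf H η h1 h2 (h3.trans (Submodule.span_mono (Set.image_mono ?_))) h4 h5)
  · rw [dotProduct_comm]; exact h5 w (h2 hw)
  · have : ((insert x A).filter fun i => X i ∉ H) ⊆ insert x (A.filter fun i => X i ∉ H) := by
      rw [Finset.filter_insert]
      split_ifs
      all_goals simp [Finset.subset_insert]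
    have := (Finset.card_le_card this).trans (Finset.card_insert_le _ _)
    omega
  · rintro i ⟨hi, hiH⟩
    exact ⟨Finset.union_subset_union (Finset.subset_insert _ _) subset_rfl hi, hiH⟩

theorem affFlat_empty (X : ι → Fin n → ℝ) (lam : ι → ℝ) : affFlat X lam ∅ = Set.univ := by
  ext t; simp [affFlat]

open scoped Classical in
theorem facetMult_eq_card [Fintype ι] (X : ι → Fin n → ℝ) (H : Submodule ℝ (Fin n → ℝ)) :
    facetMult X H = (Finset.univ.filter fun i => X i ∉ H).card := by
  rw [facetMult, Set.ncard_eq_toFinset_card' {i | X i ∉ H}]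
  congr 1
  ext i
  simp

theorem facetKilled_univ_of_mem_idealPerp [Fintype ι] [DecidableEq ι] {X : ι → Fin n → ℝ}
    (lam : ι → ℝ) {f : Poly n} (hf : f ∈ idealPerp (internalI X)) :
    FacetKilled X lam 1 Finset.univ ∅ f := by
  classical
  intro H η h1 h2 h3 h4 h5
  rw [← facetMult_eq_card, mem_idealPerp_internalI.1 hf H η ⟨h1, le_antisymm ?_ ?_⟩ h4 h5]
  · exact zero_mem _
  · exact Submodule.span_le.2 Set.inter_subset_right
  · refine h3.trans (Submodule.span_mono ?_)
    rintro _ ⟨i, ⟨-, hi⟩, rfl⟩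
    exact ⟨⟨i, rfl⟩, hi⟩

theorem vecSpan_univ [Fintype ι] {X : ι → Fin n → ℝ}
    (hX : Submodule.span ℝ (Set.range X) = ⊤) : vecSpan X Finset.univ = ⊤ := by
  rw [vecSpan, Finset.coe_univ, Set.image_univ, hX]

/-- For a facet H choose x outside H: membership in 𝓟(X \ x) gives the exponent m(H) - 1.
Conversely, the conditions for X imply the central conditions for every X \ x that still spans. -/
theorem internalP_eq_idealPerp [Fintype ι] [DecidableEq ι] {X : ι → Fin n → ℝ}
    (hX : Submodule.span ℝ (Set.range X) = ⊤) : internalP X = idealPerp (internalI X) := by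
  classical
  apply le_antisymm
  · intro f hf
    refine mem_idealPerp_internalI.2 fun H η hH hη hn => ?_
    obtain ⟨x, -, hx⟩ := exists_notMem_of_span_eq_top (X := X) (A := Finset.univ) (Z := ∅) hH.1
      (by rw [Finset.union_empty]; exact vecSpan_univ hX) (by simp [vecSpan])
    have h1 : f ∈ relCentralP X (Finset.univ.erase x) ∅ := by
      rw [relCentralP_empty_right]
      exact (Submodule.mem_iInf _).1 hf x
    have h2 := dirDeriv_iterate_eq_zero_of_mem_relCentralP hH.1 (by simp [vecSpan]) hn h1
    rwa [Finset.filter_erase, Finset.card_erase_of_mem (by simpa using hx),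
      ← facetMult_eq_card] at h2
  · intro f hf
    refine (Submodule.mem_iInf _).2 fun x => ?_
    have h1 := facetKilled_univ_of_mem_idealPerp 0 hf
    rw [← Finset.insert_erase (Finset.mem_univ x)] at h1
    by_cases hs : vecSpan X (Finset.univ.erase x ∪ ∅) = ⊤
    · obtain ⟨g, hg, hfg⟩ := exists_mem_relCentralP_sub_mem hs h1.weaken
      rw [affFlat_empty, realVanishingIdeal_univ_eq_bot, Submodule.mem_bot, sub_eq_zero] at hfg
      rw [← relCentralP_empty_right, hfg]
      exact hg
    -- A coloop x gives a facet of multiplicity one, hence a derivative of order zero, so f = 0.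
    · obtain ⟨η, -, -, h2⟩ := h1.of_coloop
        (by rw [Finset.insert_erase (Finset.mem_univ x), Finset.union_empty]; exact vecSpan_univ hX)
        hs
      rw [affFlat_empty, realVanishingIdeal_univ_eq_bot, Submodule.mem_bot] at h2
      rw [show f = 0 from h2]
      exact zero_mem _

/-! ### Bases and vertices -/

/-- The basis of `ℝⁿ` given by a basis of the configuration. -/
noncomputable def IsBasis.basis {X : ι → Fin n → ℝ} {B : Finset ι} (hB : IsBasis X B) :
    Module.Basis B ℝ (Fin n → ℝ) :=
  Module.Basis.mk (v := fun i : B => X i) hB.1 (by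
    have := hB.2
    rw [Set.image_eq_range] at this
    exact this.ge)

theorem IsBasis.basis_apply {X : ι → Fin n → ℝ} {B : Finset ι} (hB : IsBasis X B) (i : B) :
    hB.basis i = X i :=
  Module.Basis.mk_apply _ _ _

theorem IsBasis.card_eq {X : ι → Fin n → ℝ} {B : Finset ι} (hB : IsBasis X B) : B.card = n := by
  have := Module.finrank_eq_card_basis hB.basis
  rw [Module.finrank_fin_fun, Fintype.card_coe] at this
  exact this.symm

theorem IsGeneric.dotProduct_ne [DecidableEq ι] {X : ι → Fin n → ℝ} {lam : ι → ℝ}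
    (hlam : IsGeneric X lam) {B : Finset ι} (hB : IsBasis X B) {v : Fin n → ℝ}
    (hv : v ∈ affFlat X lam B) {x : ι} (hx : x ∉ B) : X x ⬝ᵥ v ≠ lam x := by
  intro h
  refine hlam (insert x B) (by rw [Finset.card_insert_of_notMem hx, hB.card_eq]) ⟨v, ?_⟩
  intro i hi
  rcases Finset.mem_insert.1 hi with rfl | hi
  exacts [h, hv i hi]

/-- A polynomial annihilated by the facet derivatives of order `m(H) - 1` vanishes on the flat of
`Z` if it vanishes at the internal vertices that lie on this flat. -/
theorem FacetKilled.mem_of_eval_eq_zero [LinearOrder ι] {X : ι → Fin n → ℝ} {lam : ι → ℝ}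
    (hlam : IsGeneric X lam) {A Z : Finset ι} {f : Poly n} (hZ : LinearIndepOn ℝ X (Z : Set ι))
    (hspan : vecSpan X (A ∪ Z) = ⊤) (hf : FacetKilled X lam 1 A Z f)
    (hv : ∀ B ⊆ A, IsBasis X (B ∪ Z) →
      (∀ b ∈ B, ¬ IsGreatest {j | j ∈ A ∧ X j ∉ vecSpan X ((B ∪ Z).erase b)} b) →
      ∀ v ∈ affFlat X lam (B ∪ Z), eval (complexPoint v) f = 0) :
    f ∈ realVanishingIdeal (affFlat X lam Z) := by
  induction A using Finset.induction_on_min generalizing Z f with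
  | empty =>
    refine mem_realVanishingIdeal.2 fun t ht => hv ∅ subset_rfl ?_ (by simp) t (by simpa using ht)
    rw [Finset.empty_union] at hspan ⊢
    exact ⟨hZ, hspan⟩
  | insert x A hmin ih =>
    have hxA : x ∉ A := fun h => lt_irrefl _ (hmin x h)
    have hgreat : ∀ {b : ι} {E : Finset ι}, b ∈ A →
        IsGreatest {j | j ∈ insert x A ∧ X j ∉ vecSpan X (E.erase b)} b →
        IsGreatest {j | j ∈ A ∧ X j ∉ vecSpan X (E.erase b)} b := fun hb h =>
      ⟨⟨hb, h.1.2⟩, fun j hj => h.2 ⟨Finset.mem_insert_of_mem hj.1, hj.2⟩⟩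
    by_cases hx : X x ∈ vecSpan X Z
    · refine ih hZ ?_ (hf.of_mem_vecSpan hx) fun B hB hbas hint =>
        hv B (hB.trans (Finset.subset_insert _ _)) hbas fun b hb h => hint b hb (hgreat (hB hb) h)
      rw [eq_top_iff, ← hspan, Finset.insert_union, vecSpan_insert]
      exact sup_le le_rfl ((Submodule.span_singleton_le_iff_mem _ _).2
        (vecSpan_mono X Finset.subset_union_right hx))
    have hxZ : x ∉ Z := fun h => hx (mem_vecSpan h)
    by_cases hs : vecSpan X (A ∪ Z) = ⊤
    swap
    -- The exponent 1 - 1 is zero: the facet condition already says that f vanishes on the flat.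
    · obtain ⟨η, -, -, h⟩ := hf.of_coloop hspan hs
      exact h
    have h1 : f ∈ realVanishingIdeal (affFlat X lam (insert x Z)) := by
      refine ih ?_ (by rwa [Finset.union_insert, ← Finset.insert_union]) hf.contract
        fun B hB hbas hint => ?_
      · rw [Finset.coe_insert]
        exact hZ.insert hx
      · rw [Finset.union_insert, ← Finset.insert_union] at hbas hint ⊢
        refine hv (insert x B) (Finset.insert_subset_insert x hB) hbas fun b hb h => ?_
        rcases Finset.mem_insert.1 hb with rfl | hb
        · apply h.1.2
          -- The smallest element, here renamed b, cannot be active. Otherwise all later vectors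
          -- would lie in the hyperplane spanned by the rest of the basis, although A ∪ Z spans. So
          -- internal bases of the contraction stay internal after adding it.
          have : vecSpan X (A ∪ Z) ≤ vecSpan X ((insert b B ∪ Z).erase b) := by
            refine vecSpan_le.2 fun i hi => ?_
            rcases Finset.mem_union.1 hi with hi | hi
            · by_contra hni
              exact (hmin i hi).not_ge (h.2 ⟨Finset.mem_insert_of_mem hi, hni⟩)
            · refine mem_vecSpan (Finset.mem_erase.2 ⟨?_, Finset.mem_union_right _ hi⟩)
              rintro rfl
              exact hxZ hi
          rw [hs, top_le_iff] at this
          rw [this]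
          exact Submodule.mem_top
        · exact hint b hb (hgreat (hB hb) h)
    obtain ⟨u, hu, hW⟩ := exists_dotProduct_eq_one hx
    rw [affFlat_insert] at h1
    obtain ⟨g, hg⟩ := exists_sub_affForm_mul_mem _ hu (add_smul_mem_affFlat (lam := lam) hW) h1
    have hk : FacetKilled X lam 1 (insert x A) Z (affForm (X x) (lam x) * g) := by
      have := hf.sub (facetKilled_of_mem 1 (insert x A) hg)
      rwa [sub_sub_cancel] at this
    have h2 : g ∈ realVanishingIdeal (affFlat X lam Z) := by
      refine ih hZ hs (hk.delete hxA hx (Or.inr ⟨rfl, hs⟩)) fun B hB hbas hint v hvB => ?_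
      have h3 := hv B (hB.trans (Finset.subset_insert _ _)) hbas
        (fun b hb h => hint b hb (hgreat (hB hb) h)) v hvB
      -- At a vertex of the deletion f vanishes, while by genericity the affine form of x does not;
      -- hence the cofactor g vanishes there.
      have h4 := mem_realVanishingIdeal.1 hg v fun i hi => hvB i (Finset.mem_union_right _ hi)
      rw [map_sub, h3, zero_sub, neg_eq_zero, map_mul, eval_affForm] at h4
      refine (mul_eq_zero.1 h4).resolve_left (Complex.ofReal_ne_zero.2 (sub_ne_zero.2 ?_))
      refine hlam.dotProduct_ne hbas hvB fun h => ?_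
      rcases Finset.mem_union.1 h with h | h
      exacts [hxA (hB h), hxZ h]
    have := Ideal.add_mem _ hg (Ideal.mul_mem_left _ (affForm (X x) (lam x)) h2)
    rwa [sub_add_cancel] at this

theorem eq_zero_of_eval_internalVertices_eq_zero [Fintype ι] [LinearOrder ι]
    {X : ι → Fin n → ℝ} (hX : Submodule.span ℝ (Set.range X) = ⊤) {lam : ι → ℝ}
    (hlam : IsGeneric X lam) {f : Poly n} (hf : f ∈ internalP X)
    (hv : ∀ v ∈ internalVertices X lam, eval (complexPoint v) f = 0) : f = 0 := by
  rw [internalP_eq_idealPerp hX] at hf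
  have h := (facetKilled_univ_of_mem_idealPerp lam hf).mem_of_eval_eq_zero hlam
    (by simp) (by rw [Finset.union_empty]; exact vecSpan_univ hX) fun B _ hB hint v hvB => by
      rw [Finset.union_empty] at hB hint hvB
      refine hv v ⟨B, ⟨hB, fun b hb h => hint b hb ?_⟩, hvB⟩
      simpa [InternallyActive, vecSpan] using h
  rwa [affFlat_empty, realVanishingIdeal_univ_eq_bot, Submodule.mem_bot] at h

end

/-! ### Correcting a product of linear forms to an element of 𝓟₋ -/

section

variable {n : ℕ} {ι : Type*}

/-! ### Explicit elements of the internal space -/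

theorem prodForm_insert [DecidableEq ι] (X : ι → Fin n → ℝ) {Y : Finset ι} {i : ι} (hi : i ∉ Y) :
    prodForm X (insert i Y) = linForm (X i) * prodForm X Y :=
  Finset.prod_insert hi

/-- Expansion of a product of linear forms in which each factor is perturbed by forms that are
smaller in the order. -/
theorem prod_linForm_sub_prodForm_mem [LinearOrder ι] (X : ι → Fin n → ℝ) {Y : Finset ι}
    {U : ι → Finset ι} (a : ι → ι → ℝ) {r : ι → ℕ} (hr : StrictMono r)
    (hlt : ∀ j ∈ Y, ∀ b ∈ U j, b < j) (hY : ∀ j ∈ Y, ∀ b ∈ U j, b ∉ Y)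
    (hU : ∀ b j j', b ∈ U j → b ∈ U j' → j = j') {S : Finset ι} (hS : S ⊆ Y) :
    (∏ j ∈ S, linForm (X j - ∑ b ∈ U j, a j b • X b)) - prodForm X S ∈
      Submodule.span ℂ {p : Poly n | ∃ T ⊆ S ∪ S.biUnion U,
        ∑ j ∈ T, r j < ∑ j ∈ S, r j ∧ p = prodForm X T} := by
  induction S using Finset.induction_on with
  | empty => simp [prodForm]
  | insert j S hj ih =>
    have hjY := hS (Finset.mem_insert_self j S)
    have hSY : S ⊆ Y := (Finset.subset_insert j S).trans hS
    -- The sets `U j` are disjoint from each other and from Y, so every product in the expansion is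
    -- squarefree and is some p_T.
    have hbS : ∀ b ∈ U j, b ∉ S ∪ S.biUnion U := by
      intro b hb h
      rcases Finset.mem_union.1 h with h | h
      · exact hY j hjY b hb (hSY h)
      · obtain ⟨j', hj', hb'⟩ := Finset.mem_biUnion.1 h
        exact hj (hU b j j' hb hb' ▸ hj')
    have hjS : j ∉ S ∪ S.biUnion U := by
      intro h
      rcases Finset.mem_union.1 h with h | h
      · exact hj h
      · obtain ⟨j', hj', hb'⟩ := Finset.mem_biUnion.1 h
        exact hY j' (hSY hj') j hb' hjY
    have hsub : S ∪ S.biUnion U ⊆ insert j S ∪ (insert j S).biUnion U :=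
      Finset.union_subset_union (Finset.subset_insert _ _)
        (Finset.biUnion_subset_biUnion_of_subset_left _ (Finset.subset_insert _ _))
    have hbmem : ∀ b ∈ U j, b ∈ insert j S ∪ (insert j S).biUnion U := fun b hb =>
      Finset.mem_union_right _ (Finset.mem_biUnion.2 ⟨j, Finset.mem_insert_self _ _, hb⟩)
    have hjmem : j ∈ insert j S ∪ (insert j S).biUnion U :=
      Finset.mem_union_left _ (Finset.mem_insert_self _ _)
    set N := Submodule.span ℂ {p : Poly n | ∃ T ⊆ insert j S ∪ (insert j S).biUnion U,
        ∑ j ∈ T, r j < ∑ j ∈ insert j S, r j ∧ p = prodForm X T} with hN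
    set R := (∏ j ∈ S, linForm (X j - ∑ b ∈ U j, a j b • X b)) - prodForm X S with hR
    have hb1 : ∀ b ∈ U j, linForm (X b) * prodForm X S ∈ N := by
      intro b hb
      have hb0 : b ∉ S := fun h => hbS b hb (Finset.mem_union_left _ h)
      refine Submodule.subset_span ⟨insert b S, ?_, ?_, (prodForm_insert X hb0).symm⟩
      · exact Finset.insert_subset (hbmem b hb) (Finset.subset_union_left.trans hsub)
      · rw [Finset.sum_insert hb0, Finset.sum_insert hj]
        exact Nat.add_lt_add_right (hr (hlt j hjY b hb)) _
    have hmul' : ∀ i, i ∉ S ∪ S.biUnion U → i ∈ insert j S ∪ (insert j S).biUnion U → r i ≤ r j →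
        ∀ p ∈ Submodule.span ℂ {p : Poly n | ∃ T ⊆ S ∪ S.biUnion U,
          ∑ j ∈ T, r j < ∑ j ∈ S, r j ∧ p = prodForm X T}, linForm (X i) * p ∈ N := by
      intro i hi hi' hij p hp
      induction hp using Submodule.span_induction with
      | zero => rw [mul_zero]; exact zero_mem _
      | add p q _ _ hp hq => rw [mul_add]; exact add_mem hp hq
      | smul c p _ hp => rw [mul_smul_comm]; exact Submodule.smul_mem _ _ hp
      | mem p hp =>
        obtain ⟨T, hT, hw, rfl⟩ := hp
        have hiT : i ∉ T := fun h => hi (hT h)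
        refine Submodule.subset_span ⟨insert i T, ?_, ?_, (prodForm_insert X hiT).symm⟩
        · exact Finset.insert_subset hi' (hT.trans hsub)
        · rw [Finset.sum_insert hiT, Finset.sum_insert hj]
          exact Nat.add_lt_add_of_le_of_lt hij hw
    have hmul := fun i hi hi' hij => hmul' i hi hi' hij R (ih hSY)
    have hexp : (∏ j ∈ insert j S, linForm (X j - ∑ b ∈ U j, a j b • X b)) -
        prodForm X (insert j S) = linForm (X j) * R -
        ∑ b ∈ U j, (a j b : ℂ) • (linForm (X b) * prodForm X S + linForm (X b) * R) := by
      rw [Finset.prod_insert hj, prodForm_insert X hj,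
        show (∏ j ∈ S, linForm (X j - ∑ b ∈ U j, a j b • X b)) = prodForm X S + R by
          rw [hR]; ring, linForm_sub, linForm_sum]
      simp only [linForm_smul, ← mul_add, ← smul_mul_assoc, ← Finset.sum_mul]
      ring
    rw [hexp]
    refine sub_mem (hmul j hjS hjmem le_rfl) (sum_mem fun b hb => Submodule.smul_mem _ _ ?_)
    exact add_mem (hb1 b hb) (hmul b (hbS b hb) (hbmem b hb) (hr (hlt j hjY b hb)).le)

/-- Coordinates with respect to a basis of the configuration. -/
theorem IsBasis.exists_coords {X : ι → Fin n → ℝ} {B : Finset ι} (hB : IsBasis X B) :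
    ∃ a : ι → ι → ℝ, (∀ j, X j = ∑ b ∈ B, a j b • X b) ∧
      ∀ b ∈ B, ∀ c ∈ B, c ≠ b → a c b = 0 := by
  classical
  refine ⟨fun j b => if hb : b ∈ B then hB.basis.repr (X j) ⟨b, hb⟩ else 0, fun j => ?_,
    fun b hb c hc hcb => ?_⟩
  · conv_lhs => rw [← hB.basis.sum_repr (X j)]
    rw [← Finset.sum_coe_sort B]
    refine Finset.sum_congr rfl fun b _ => ?_
    simp only [dif_pos b.2, hB.basis_apply]
  · simp only [dif_pos hb]
    rw [← hB.basis_apply ⟨c, hc⟩, Module.Basis.repr_self, Finsupp.single_eq_of_ne]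
    exact fun h => hcb (congrArg Subtype.val h).symm

theorem IsBasis.notMem_vecSpan_erase [DecidableEq ι] {X : ι → Fin n → ℝ} {B : Finset ι}
    (hB : IsBasis X B) {b : ι} (hb : b ∈ B) : X b ∉ vecSpan X (B.erase b) := by
  rw [vecSpan, Finset.coe_erase, (hB.1.mono (Set.sdiff_subset (t := {b}))).notMem_span_iff (a := b)]
  exact ⟨hB.1.mono (Set.insert_subset hb Set.sdiff_subset), by simp⟩

/-- This is where internality enters: b is not the last vector outside span (B \ b), so the last
vector with nonzero b-coordinate comes strictly after b. Replacing it by b then lowers the weight.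
-/
theorem exists_greatest_coord [Fintype ι] [LinearOrder ι] {X : ι → Fin n → ℝ} {B : Finset ι}
    (hB : B ∈ internalBases X) {a : ι → ι → ℝ} (ha : ∀ j, X j = ∑ b ∈ B, a j b • X b) :
    ∃ y : ι → ι, ∀ b ∈ B, b < y b ∧ a (y b) b ≠ 0 ∧ ∀ j, a j b ≠ 0 → j ≤ y b := by
  classical
  have key : ∀ b, ∃ y, b ∈ B → b < y ∧ a y b ≠ 0 ∧ ∀ j, a j b ≠ 0 → j ≤ y := by
    intro b
    by_cases hb : b ∈ B
    swap
    · exact ⟨b, fun h => absurd h hb⟩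
    have hne : ∀ j, X j ∉ vecSpan X (B.erase b) → a j b ≠ 0 := by
      intro j hj h0
      apply hj
      rw [ha j, ← Finset.add_sum_erase _ _ hb, h0, zero_smul, zero_add]
      exact sum_mem fun i hi => Submodule.smul_mem _ _ (mem_vecSpan hi)
    have hbb := hB.1.notMem_vecSpan_erase hb
    obtain ⟨j, hjb, hj⟩ : ∃ j, b < j ∧ X j ∉ vecSpan X (B.erase b) := by
      by_contra! h
      refine hB.2 b hb ⟨by simpa [vecSpan] using hbb, fun j hj => ?_⟩
      by_contra hlt
      exact hj (by simpa [vecSpan] using h j (not_le.1 hlt))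
    have hs : (Finset.univ.filter fun j => a j b ≠ 0).Nonempty :=
      ⟨j, Finset.mem_filter.2 ⟨Finset.mem_univ _, hne j hj⟩⟩
    refine ⟨(Finset.univ.filter fun j => a j b ≠ 0).max' hs, fun _ =>
      ⟨hjb.trans_le (Finset.le_max' _ j ?_), ?_, fun i hi => ?_⟩⟩
    · exact Finset.mem_filter.2 ⟨Finset.mem_univ _, hne j hj⟩
    · exact (Finset.mem_filter.1 (Finset.max'_mem _ hs)).2
    · exact Finset.le_max' _ i (Finset.mem_filter.2 ⟨Finset.mem_univ _, hi⟩)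
  choose y hy using key
  exact ⟨y, hy⟩

/-- The number of the modified forms that do not vanish on a hyperplane. -/
theorem card_modified_add_two_le [Fintype ι] [LinearOrder ι] {X : ι → Fin n → ℝ}
    {B C : Finset ι} (hBC : B ⊆ C) (hB : IsBasis X B) {a : ι → ι → ℝ}
    (ha : ∀ j, X j = ∑ b ∈ B, a j b • X b) (ha0 : ∀ b ∈ B, ∀ c ∈ B, c ≠ b → a c b = 0)
    {y : ι → ι} (hy : ∀ b ∈ B, b < y b ∧ a (y b) b ≠ 0 ∧ ∀ j, a j b ≠ 0 → j ≤ y b)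
    {L : Finset ι} (hL : ∀ b, b ∈ L ↔ b ∈ B ∧ ∀ c ∈ C, c ≠ b → a c b = 0)
    {η : Fin n → ℝ} (hη : η ≠ 0) :
    (Cᶜ.filter fun j =>
      η ⬝ᵥ (X j - ∑ b ∈ L.filter (fun b => y b = j), a j b • X b) ≠ 0).card + 2 ≤
      (Finset.univ.filter fun j => η ⬝ᵥ X j ≠ 0).card := by
  classical
  set q : ι → Fin n → ℝ := fun j => X j - ∑ b ∈ L.filter (fun b => y b = j), a j b • X b with hq
  have heta : ∀ j, η ⬝ᵥ X j = ∑ b ∈ B, a j b * (η ⬝ᵥ X b) := by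
    intro j
    conv_lhs => rw [ha j]
    rw [dotProduct_sum]
    simp only [dotProduct_smul, smul_eq_mul]
  have hetaq : ∀ j, η ⬝ᵥ q j =
      η ⬝ᵥ X j - ∑ b ∈ L.filter (fun b => y b = j), a j b * (η ⬝ᵥ X b) := by
    intro j
    rw [hq, dotProduct_sub, dotProduct_sum]
    simp only [dotProduct_smul, smul_eq_mul]
  -- The target is N + E, where E counts the vectors of C off the hyperplane, split into those in L
  -- (coloops of C) and the others, `E₂`.
  set N := Cᶜ.filter fun j => η ⬝ᵥ X j ≠ 0 with hN
  set E := C.filter fun j => η ⬝ᵥ X j ≠ 0 with hE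
  have hNE : (Finset.univ.filter fun j => η ⬝ᵥ X j ≠ 0).card = N.card + E.card := by
    rw [hN, hE, ← Finset.card_union_of_disjoint, ← Finset.filter_union, Finset.union_comm,
      Finset.union_compl]
    exact Finset.disjoint_filter_filter disjoint_compl_left
  set E₁ := E.filter (· ∈ L) with hE₁
  set E₂ := E.filter (· ∉ L) with hE₂
  have hE12 : E₁.card + E₂.card = E.card := Finset.card_filter_add_card_filter_not _
  set F := Cᶜ.filter fun j => η ⬝ᵥ q j ≠ 0 with hF
  have hFsub : F ⊆ N ∪ E₁.image y := by
    intro j hj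
    rw [hF, Finset.mem_filter] at hj
    by_contra hjN
    rw [Finset.mem_union, not_or] at hjN
    apply hj.2
    have h1 : η ⬝ᵥ X j = 0 := by
      by_contra h
      exact hjN.1 (Finset.mem_filter.2 ⟨hj.1, h⟩)
    rw [hetaq, h1, zero_sub, neg_eq_zero]
    refine Finset.sum_eq_zero fun b hb => ?_
    rw [Finset.mem_filter] at hb
    by_contra h
    refine hjN.2 (Finset.mem_image.2 ⟨b, Finset.mem_filter.2 ⟨Finset.mem_filter.2
      ⟨hBC ((hL b).1 hb.1).1, right_ne_zero_of_mul h⟩, hb.1⟩, hb.2⟩)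
  -- If e were the only element, expanding in B would show that e lies in B and that no other vector
  -- of C has an e-coordinate. Then e would belong to L.
  have hE2 : E₂.card ≠ 1 := by
    intro h
    obtain ⟨e, he⟩ := Finset.card_eq_one.1 h
    have heE : e ∈ E₂ := he ▸ Finset.mem_singleton_self e
    rw [hE₂, Finset.mem_filter, hE, Finset.mem_filter] at heE
    obtain ⟨⟨heC, hene⟩, heL⟩ := heE
    have hzero : ∀ c ∈ C, c ∉ L → c ≠ e → η ⬝ᵥ X c = 0 := by
      intro c hc hcL hce
      by_contra h0
      have : c ∈ E₂ := Finset.mem_filter.2 ⟨Finset.mem_filter.2 ⟨hc, h0⟩, hcL⟩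
      rw [he, Finset.mem_singleton] at this
      exact hce this
    have hsum : ∀ c ∈ C, c ∉ L → η ⬝ᵥ X c = if e ∈ B then a c e * (η ⬝ᵥ X e) else 0 := by
      intro c hc hcL
      rw [heta c, ← Finset.sum_ite_eq' B e fun b => a c b * (η ⬝ᵥ X b)]
      refine Finset.sum_congr rfl fun b hb => ?_
      split_ifs with hbe
      · rfl
      · by_cases hbL : b ∈ L
        · rw [((hL b).1 hbL).2 c hc (fun h => hcL (h ▸ hbL)), zero_mul]
        · rw [hzero b (hBC hb) hbL hbe, mul_zero]
    have heB : e ∈ B := by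
      by_contra heB
      have := hsum e heC heL
      rw [if_neg heB] at this
      exact hene this
    refine heL ((hL e).2 ⟨heB, fun c hc hce => ?_⟩)
    by_cases hcL : c ∈ L
    · exact ha0 e heB c ((hL c).1 hcL).1 hce
    · have := hsum c hc hcL
      rw [if_pos heB, hzero c hc hcL hce] at this
      exact (mul_eq_zero.1 this.symm).resolve_right hene
  have himg : (E₁.image y).card ≤ E₁.card := Finset.card_image_le
  rw [hNE]
  change F.card + 2 ≤ _
  -- If `E₂` is nonempty it has at least two elements, which is the required gain. Otherwise the
  -- gain of two must come from the corrections.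
  by_cases h2 : E₂ = ∅
  swap
  · have h3 : 0 < E₂.card := Finset.card_pos.2 (Finset.nonempty_iff_ne_empty.2 h2)
    have := (Finset.card_le_card hFsub).trans (Finset.card_union_le _ _)
    omega
  have hEL : ∀ b ∈ B, η ⬝ᵥ X b ≠ 0 → b ∈ E₁ := by
    intro b hb hne
    have hbE : b ∈ E := Finset.mem_filter.2 ⟨hBC hb, hne⟩
    by_contra h
    have : b ∈ E₂ := Finset.mem_filter.2 ⟨hbE, fun hbL => h (Finset.mem_filter.2 ⟨hbE, hbL⟩)⟩
    rw [h2] at this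
    simp at this
  have hE1ne : E₁.Nonempty := by
    by_contra h
    rw [Finset.not_nonempty_iff_eq_empty] at h
    apply hη
    refine eq_zero_of_forall_dotProduct hB.2 ?_
    rintro _ ⟨b, hb, rfl⟩
    by_contra hne
    have := hEL b hb hne
    rw [h] at this
    simp at this
  have himgne : (E₁.image y).Nonempty := hE1ne.image y
  set m := (E₁.image y).max' himgne with hm
  have hmE : m ∈ E₁.image y := Finset.max'_mem _ _
  have hmax : ∀ b ∈ B, a m b * (η ⬝ᵥ X b) ≠ 0 → b ∈ E₁ ∧ y b = m := by
    intro b hb hne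
    have h3 := hEL b hb (right_ne_zero_of_mul hne)
    exact ⟨h3, le_antisymm (Finset.le_max' _ _ (Finset.mem_image_of_mem y h3))
      ((hy b hb).2.2 m (left_ne_zero_of_mul hne))⟩
  -- At the last corrected index m, every basis vector contributing to η·X_m has m as its own last
  -- index, so the correction removes all of η·X_m.
  have hqm : η ⬝ᵥ q m = 0 := by
    rw [hetaq, sub_eq_zero, heta]
    symm
    refine Finset.sum_subset (fun b hb => ((hL b).1 (Finset.mem_filter.1 hb).1).1)
      fun b hb hbU => ?_
    by_contra hne
    obtain ⟨h3, h4⟩ := hmax b hb hne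
    exact hbU (Finset.mem_filter.2 ⟨(Finset.mem_filter.1 h3).2, h4⟩)
  have hFsub' : F ⊆ N.erase m ∪ (E₁.image y).erase m := by
    intro j hj
    have hjm : j ≠ m := by
      rintro rfl
      exact (Finset.mem_filter.1 hj).2 hqm
    rcases Finset.mem_union.1 (hFsub hj) with h | h
    · exact Finset.mem_union_left _ (Finset.mem_erase.2 ⟨hjm, h⟩)
    · exact Finset.mem_union_right _ (Finset.mem_erase.2 ⟨hjm, h⟩)
  have hcard := (Finset.card_le_card hFsub').trans (Finset.card_union_le _ _)
  rw [Finset.card_erase_of_mem hmE] at hcard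
  have himgpos : 0 < (E₁.image y).card := Finset.card_pos.2 himgne
  -- If m is in N, it was counted in both N and the image of y, so dropping it gains two.
  by_cases hmN : m ∈ N
  · rw [Finset.card_erase_of_mem hmN] at hcard
    have : 0 < N.card := Finset.card_pos.2 ⟨m, hmN⟩
    omega
  · have hN' := Finset.card_le_card (Finset.erase_subset m N)
    obtain ⟨b₀, hb₀, hyb₀⟩ := Finset.mem_image.1 hmE
    have hb₀L := (hL b₀).1 (Finset.mem_filter.1 hb₀).2
    have hb₀E := (Finset.mem_filter.1 (Finset.mem_filter.1 hb₀).1).2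
    have h3 : η ⬝ᵥ X m = 0 := by
      by_contra h
      refine hmN (Finset.mem_filter.2 ⟨Finset.mem_compl.2 fun hmC => ?_, h⟩)
      have h4 := hy b₀ hb₀L.1
      rw [hyb₀] at h4
      exact h4.2.1 (hb₀L.2 m hmC h4.1.ne')
    -- Otherwise η·X_m = 0. Were y injective on `E₁`, only one term of this sum would survive and be
    -- nonzero; so the image loses one element, and dropping m gains another.
    have h4 : (E₁.image y).card ≠ E₁.card := by
      intro h
      have hinj := Finset.card_image_iff.1 h
      rw [heta, Finset.sum_eq_single b₀] at h3
      · have h5 := (hy b₀ hb₀L.1).2.1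
        rw [hyb₀] at h5
        exact (mul_ne_zero h5 hb₀E) h3
      · intro b hb hbb
        by_contra hne
        obtain ⟨h5, h6⟩ := hmax b hb hne
        exact hbb (hinj h5 hb₀ (h6.trans hyb₀.symm))
      · exact fun h => absurd hb₀L.1 h
    omega

end

/-! ### The sum 𝓟₋ + 𝓙₋, the varieties, and generic vertices -/

section

variable {n : ℕ} {ι : Type*}

/-! ### `𝓟₋ + 𝓙₋ = Π` -/

/-- Membership is tested by derivatives of order m(H) - 1, so the number of factors varying along
the normal must be at most m(H) - 2; hence the margin of two. -/
theorem prod_linForm_mem_internalP [Fintype ι] [DecidableEq ι] {X : ι → Fin n → ℝ}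
    (hX : Submodule.span ℝ (Set.range X) = ⊤) {Y : Finset ι} (q : ι → Fin n → ℝ)
    (hq : ∀ η : Fin n → ℝ, η ≠ 0 → (Y.filter fun j => η ⬝ᵥ q j ≠ 0).card + 2 ≤
      (Finset.univ.filter fun j => η ⬝ᵥ X j ≠ 0).card) :
    ∏ j ∈ Y, linForm (q j) ∈ internalP X := by
  classical
  rw [internalP_eq_idealPerp hX]
  refine mem_idealPerp_internalI.2 fun H η hH hη hn => ?_
  apply dirDeriv_iterate_prod_linForm_eq_zero
  have h : facetMult X H = (Finset.univ.filter fun j => η ⬝ᵥ X j ≠ 0).card := by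
    rw [facetMult_eq_card]
    congr 1
    ext i
    simp only [Finset.mem_filter_univ]
    exact ⟨dotProduct_ne_zero_of_notMem hH.1 hη hn, fun h hi => h (hn _ hi)⟩
  have := hq η hη
  rw [h]
  omega

theorem exists_internalBasis_disjoint [LinearOrder ι] {X : ι → Fin n → ℝ} {Y : Finset ι}
    (hY : Y ∉ barelyLong X) : ∃ B ∈ internalBases X, Y ∩ B = ∅ := by
  simpa [barelyLong, Finset.not_nonempty_iff_eq_empty] using hY

theorem prodForm_mem_internalP_sup_internalJ [Fintype ι] [LinearOrder ι] {X : ι → Fin n → ℝ}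
    (hX : Submodule.span ℝ (Set.range X) = ⊤) (Y : Finset ι) :
    prodForm X Y ∈ internalP X ⊔ (internalJ X).restrictScalars ℂ := by
  classical
  set r : ι → ℕ := fun i => (Finset.univ.filter (· < i)).card with hr
  have hrmono : StrictMono r := by
    intro i j hij
    refine Finset.card_lt_card (Finset.ssubset_iff_subset_ne.2 ⟨fun k hk => ?_, fun h => ?_⟩)
    · simp only [Finset.mem_filter_univ] at hk ⊢
      exact hk.trans hij
    · have : i ∈ Finset.univ.filter (· < j) := by simpa using hij
      rw [← h] at this
      simp at this
  induction hw : ∑ j ∈ Y, r j using Nat.strong_induction_on generalizing Y with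
  -- Induction on the sum of the ranks of the elements of Y in the order.
  | _ w ih =>
  by_cases hY : Y ∈ barelyLong X
  · exact Submodule.mem_sup_right (Ideal.subset_span ⟨Y, hY, rfl⟩)
  obtain ⟨B, hB, hYB⟩ := exists_internalBasis_disjoint hY
  have hBC : B ⊆ Yᶜ := fun b hb => Finset.mem_compl.2 fun hbY => by
    have : b ∈ Y ∩ B := Finset.mem_inter.2 ⟨hbY, hb⟩
    simp [hYB] at this
  obtain ⟨a, ha, ha0⟩ := hB.1.exists_coords
  obtain ⟨y, hy⟩ := exists_greatest_coord hB ha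
  -- L collects the coloops of the complement of Y that lie in B. Only these force corrections: each
  -- b in L is subtracted, with its coefficient, from the form of its last index `y b`.
  set L := B.filter fun b => ∀ c ∈ Yᶜ, c ≠ b → a c b = 0 with hLdef
  have hL : ∀ b, b ∈ L ↔ b ∈ B ∧ ∀ c ∈ Yᶜ, c ≠ b → a c b = 0 := fun b => Finset.mem_filter
  have hQ : ∏ j ∈ Y, linForm (X j - ∑ b ∈ L.filter (fun b => y b = j), a j b • X b) ∈
      internalP X := by
    refine prod_linForm_mem_internalP hX _ fun η hη => ?_
    have := card_modified_add_two_le hBC hB.1 ha ha0 hy hL hη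
    rwa [compl_compl] at this
  have hexp := prod_linForm_sub_prodForm_mem X (Y := Y) (U := fun j => L.filter (fun b => y b = j))
    a hrmono ?_ ?_ ?_ subset_rfl
  · have hle : Submodule.span ℂ {p : Poly n | ∃ T ⊆ Y ∪ Y.biUnion fun j =>
        L.filter (fun b => y b = j), ∑ j ∈ T, r j < ∑ j ∈ Y, r j ∧ p = prodForm X T} ≤
        internalP X ⊔ (internalJ X).restrictScalars ℂ := by
      refine Submodule.span_le.2 ?_
      rintro _ ⟨T, -, hT, rfl⟩
      exact ih _ (hw ▸ hT) T rfl
    have := sub_mem (Submodule.mem_sup_left (T := (internalJ X).restrictScalars ℂ) hQ) (hle hexp)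
    rwa [sub_sub_cancel] at this
  · intro j _ b hb
    obtain ⟨hbL, rfl⟩ := Finset.mem_filter.1 hb
    exact (hy b ((hL b).1 hbL).1).1
  · intro j _ b hb
    exact Finset.mem_compl.1 (hBC ((hL b).1 (Finset.mem_filter.1 hb).1).1)
  · intro b j j' hb hb'
    rw [← (Finset.mem_filter.1 hb).2, (Finset.mem_filter.1 hb').2]

/-- The left side is stable under multiplication by linear forms. If Y is not barely long it misses
an internal basis B; rewriting a form in B turns its product with p_Y into a combination of the p_{Y
∪ b}. -/
theorem span_prodForm_sup_internalJ [Fintype ι] [LinearOrder ι] {X : ι → Fin n → ℝ}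
    (hX : Submodule.span ℝ (Set.range X) = ⊤) :
    Submodule.span ℂ (Set.range (prodForm X)) ⊔ (internalJ X).restrictScalars ℂ = ⊤ := by
  classical
  set M := Submodule.span ℂ (Set.range (prodForm X)) ⊔ (internalJ X).restrictScalars ℂ with hM
  have hmem : ∀ Y, prodForm X Y ∈ M := fun Y =>
    Submodule.mem_sup_left (Submodule.subset_span ⟨Y, rfl⟩)
  have hmulX : ∀ i Y, prodForm X Y * linForm (X i) ∈ M := by
    intro i Y
    by_cases hY : Y ∈ barelyLong X
    · exact Submodule.mem_sup_right (Ideal.mul_mem_right _ (internalJ X)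
        (Ideal.subset_span ⟨Y, hY, rfl⟩))
    obtain ⟨B, hB, hYB⟩ := exists_internalBasis_disjoint hY
    have hi : linForm (X i) ∈ Submodule.span ℂ (linForm '' (X '' (B : Set ι))) :=
      linForm_mem_span_of_mem_span (hB.1.2 ▸ Submodule.mem_top)
    generalize linForm (X i) = l at hi
    induction hi using Submodule.span_induction with
    | zero => rw [mul_zero]; exact zero_mem _
    | add p q _ _ hp hq => rw [mul_add]; exact add_mem hp hq
    | smul c p _ hp => rw [mul_smul_comm]; exact Submodule.smul_mem _ _ hp
    | mem p hp =>
      obtain ⟨_, ⟨b, hb, rfl⟩, rfl⟩ := hp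
      have hbY : b ∉ Y := fun h => by
        have : b ∈ Y ∩ B := Finset.mem_inter.2 ⟨h, hb⟩
        simp [hYB] at this
      rw [mul_comm, ← prodForm_insert X hbY]
      exact hmem _
  have hmul : ∀ x : Fin n → ℝ, ∀ p ∈ M, p * linForm x ∈ M := by
    intro x p hp
    have hx : linForm x ∈ Submodule.span ℂ (linForm '' (Set.range X)) :=
      linForm_mem_span_of_mem_span (hX ▸ Submodule.mem_top)
    generalize linForm x = l at hx
    obtain ⟨p₁, hp₁, p₂, hp₂, rfl⟩ := Submodule.mem_sup.1 hp
    rw [add_mul]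
    refine add_mem ?_ (Submodule.mem_sup_right (Ideal.mul_mem_right _ (internalJ X) hp₂))
    clear hp
    induction hp₁ using Submodule.span_induction with
    | zero => rw [zero_mul]; exact zero_mem _
    | add p q _ _ h1 h2 => rw [add_mul]; exact add_mem h1 h2
    | smul c p _ h => rw [smul_mul_assoc]; exact Submodule.smul_mem _ _ h
    | mem p hp =>
      obtain ⟨Y, rfl⟩ := hp
      induction hx using Submodule.span_induction with
      | zero => rw [mul_zero]; exact zero_mem _
      | add p q _ _ hp hq => rw [mul_add]; exact add_mem hp hq
      | smul c p _ hp => rw [mul_smul_comm]; exact Submodule.smul_mem _ _ hp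
      | mem p hp =>
        obtain ⟨_, ⟨i, rfl⟩, rfl⟩ := hp
        exact hmulX i Y
  refine (Submodule.eq_top_iff').2 fun p => ?_
  induction p using MvPolynomial.induction_on with
  | C c =>
    rw [← mul_one (C c), ← smul_eq_C_mul]
    refine Submodule.smul_mem _ _ ?_
    simpa [prodForm] using hmem ∅
  | add p q hp hq => exact add_mem hp hq
  | mul_X p i hp =>
    rw [← linForm_single]
    exact hmul _ p hp

theorem internalP_sup_internalJ [Fintype ι] [LinearOrder ι] {X : ι → Fin n → ℝ}
    (hX : Submodule.span ℝ (Set.range X) = ⊤) :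
    internalP X ⊔ (internalJ X).restrictScalars ℂ = ⊤ := by
  rw [eq_top_iff, ← span_prodForm_sup_internalJ hX]
  refine sup_le (Submodule.span_le.2 ?_) le_sup_right
  rintro _ ⟨Y, rfl⟩
  exact prodForm_mem_internalP_sup_internalJ hX Y

/-! ### The varieties of the ideals -/

theorem eq_zero_of_eval_linForm_eq_zero {s : Set (Fin n → ℝ)} (hs : Submodule.span ℝ s = ⊤)
    {θ : Fin n → ℂ} (h : ∀ x ∈ s, eval θ (linForm x) = 0) : θ = 0 := by
  funext i
  have hi : linForm (Pi.single i 1) ∈ Submodule.span ℂ (linForm '' s) :=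
    linForm_mem_span_of_mem_span (hs ▸ Submodule.mem_top)
  have hle : Submodule.span ℂ (linForm '' s) ≤
      LinearMap.ker (aeval θ : Poly n →ₐ[ℂ] ℂ).toLinearMap := by
    refine Submodule.span_le.2 ?_
    rintro _ ⟨x, hx, rfl⟩
    exact h x hx
  have := hle hi
  rw [linForm_single, LinearMap.mem_ker] at this
  simpa using this

theorem eval_zero_linForm (x : Fin n → ℝ) : eval 0 (linForm x) = 0 := by
  simp [linForm]

theorem map_internalD_eq_idealKer [Fintype ι] [LinearOrder ι] (X : ι → Fin n → ℝ) :
    (internalD X).map (toSeries n) = idealKer (internalJ X) := by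
  classical
  rw [internalD_eq_idealPerp, internalJ]
  refine map_idealPerp_eq_idealKer ?_ fun θ hθ => ?_
  · rintro _ ⟨Y, -, rfl⟩
    rcases Y.eq_empty_or_nonempty with rfl | ⟨y, hy⟩
    · exact Or.inr (by simp [prodForm])
    · left
      rw [prodForm, map_prod]
      exact Finset.prod_eq_zero hy (eval_zero_linForm _)
  -- The product of all forms nonzero at θ is nonzero at θ, so its index set misses some internal
  -- basis. All forms of that basis vanish at θ, whence θ = 0.
  · have hY : (Finset.univ.filter fun i => eval θ (linForm (X i)) ≠ 0) ∉ barelyLong X := by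
      intro hY
      have h := hθ _ (Ideal.subset_span ⟨_, hY, rfl⟩)
      rw [prodForm, map_prod, Finset.prod_eq_zero_iff] at h
      obtain ⟨i, hi, h0⟩ := h
      exact (Finset.mem_filter.1 hi).2 h0
    obtain ⟨B, hB, hYB⟩ := exists_internalBasis_disjoint hY
    refine eq_zero_of_eval_linForm_eq_zero hB.1.2 ?_
    rintro _ ⟨b, hb, rfl⟩
    by_contra hne
    have : b ∈ (Finset.univ.filter fun i => eval θ (linForm (X i)) ≠ 0) ∩ B :=
      Finset.mem_inter.2 ⟨by simpa using hne, hb⟩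
    rw [hYB] at this
    simp at this

theorem exists_isBasis [Fintype ι] {X : ι → Fin n → ℝ}
    (hX : Submodule.span ℝ (Set.range X) = ⊤) : ∃ B : Finset ι, IsBasis X B := by
  classical
  obtain ⟨b, -, hb1, hb2, hb3⟩ := exists_linearIndepOn_extension (K := ℝ) (v := X)
    (linearIndepOn_empty ℝ X) (Set.empty_subset Set.univ)
  refine ⟨b.toFinset, by simpa using hb3, ?_⟩
  rw [Set.coe_toFinset, eq_top_iff, ← hX, Submodule.span_le]
  rwa [Set.image_univ] at hb2

/-- The normals of the facet hyperplanes span `ℝⁿ`. -/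
theorem span_facet_normals [Fintype ι] {X : ι → Fin n → ℝ}
    (hX : Submodule.span ℝ (Set.range X) = ⊤) :
    Submodule.span ℝ {η : Fin n → ℝ | ∃ H, IsFacetHyperplane X H ∧ η ≠ 0 ∧
      ∀ h ∈ H, η ⬝ᵥ h = 0} = ⊤ := by
  classical
  by_contra hne
  obtain ⟨x, hx, hxn⟩ := exists_normal hne
  obtain ⟨B, hB⟩ := exists_isBasis hX
  apply hx
  rw [← hB.basis.sum_repr x]
  refine Finset.sum_eq_zero fun b _ => ?_
  -- A vector x orthogonal to all facet normals has zero b-coordinate, as seen by the normal of the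
  -- facet spanned by B \ b.
  have hb := hB.notMem_vecSpan_erase b.2
  have htop : vecSpan X (B.erase b) ⊔ Submodule.span ℝ {X b} = ⊤ := by
    rw [← vecSpan_insert, Finset.insert_erase b.2]
    exact hB.2
  have hH : vecSpan X (B.erase b) ≠ ⊤ := fun h => hb (h ▸ Submodule.mem_top)
  obtain ⟨η, hη, hn⟩ := exists_normal hH
  have hfr := finrank_add_one_eq hH htop
  have hfacet : IsFacetHyperplane X (vecSpan X (B.erase b)) := by
    refine ⟨hfr, le_antisymm (Submodule.span_le.2 Set.inter_subset_right)
      (Submodule.span_mono ?_)⟩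
    rintro _ ⟨i, hi, rfl⟩
    exact ⟨⟨i, rfl⟩, mem_vecSpan hi⟩
  have h1 : η ⬝ᵥ x = 0 := by
    rw [dotProduct_comm]
    exact hxn η (Submodule.subset_span ⟨_, hfacet, hη, hn⟩)
  rw [← hB.basis.sum_repr x, dotProduct_sum, Finset.sum_eq_single b, dotProduct_smul,
    hB.basis_apply, smul_eq_mul] at h1
  · rw [(mul_eq_zero.1 h1).resolve_right (dotProduct_ne_zero_of_notMem hfr hη hn hb), zero_smul]
  · intro c _ hc
    rw [dotProduct_smul, hB.basis_apply, hn _ (mem_vecSpan (Finset.mem_erase.2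
      ⟨fun h => hc (Subtype.ext h), c.2⟩)), smul_zero]
  · exact fun h => absurd (Finset.mem_univ _) h

theorem map_internalP_eq_idealKer [Fintype ι] [DecidableEq ι] {X : ι → Fin n → ℝ}
    (hX : Submodule.span ℝ (Set.range X) = ⊤) :
    (internalP X).map (toSeries n) = idealKer (internalI X) := by
  rw [internalP_eq_idealPerp hX, internalI]
  refine map_idealPerp_eq_idealKer ?_ fun θ hθ => ?_
  · rintro _ ⟨H, η, -, -, -, rfl⟩
    rcases Nat.eq_zero_or_pos (facetMult X H - 1) with h | h
    · right; rw [h, pow_zero]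
    · left; rw [map_pow, eval_zero_linForm, zero_pow h.ne']
  · refine eq_zero_of_eval_linForm_eq_zero (span_facet_normals hX) ?_
    rintro η ⟨H, hH, hη, hn⟩
    have h := hθ _ (Ideal.subset_span ⟨H, η, hH, hη, hn, rfl⟩)
    rw [map_pow] at h
    exact eq_zero_of_pow_eq_zero h

/-! ### Generic arrangements and their vertices -/

/-- For each S with n + 1 elements, the bad λ form a proper subspace, since ℝⁿ cannot map onto ℝ^S.
Finitely many proper subspaces do not cover ℝ^X. -/
theorem exists_isGeneric [Fintype ι] (X : ι → Fin n → ℝ) : ∃ lam : ι → ℝ, IsGeneric X lam := by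
  classical
  let L : ∀ S : Finset ι, (Fin n → ℝ) →ₗ[ℝ] S → ℝ := fun S =>
    Matrix.mulVecLin (Matrix.of fun i : S => X i)
  let M : Finset ι → Submodule ℝ (ι → ℝ) := fun S =>
    (LinearMap.range (L S)).comap (LinearMap.funLeft ℝ ℝ (Subtype.val : S → ι))
  let s : Finset (Subspace ℝ (ι → ℝ)) :=
    (Finset.univ.filter fun S : Finset ι => S.card = n + 1).image M
  have hs : ⊤ ∉ s := by
    intro h
    obtain ⟨S, hS, hM⟩ := Finset.mem_image.1 h
    rw [Finset.mem_filter_univ] at hS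
    have hsurj : Function.Surjective (L S) := by
      intro g
      obtain ⟨lam, rfl⟩ :=
        LinearMap.funLeft_surjective_of_injective ℝ ℝ (Subtype.val : S → ι) Subtype.val_injective g
      have : lam ∈ M S := hM ▸ Submodule.mem_top
      exact this
    have := LinearMap.finrank_le_finrank_of_surjective hsurj
    rw [Module.finrank_fintype_fun_eq_card, Module.finrank_fin_fun, Fintype.card_coe, hS] at this
    omega
  have hne := Subspace.biUnion_ne_univ_of_top_notMem hs
  obtain ⟨lam, hlam⟩ := (Set.ne_univ_iff_exists_notMem _).1 hne
  refine ⟨lam, fun S hS => ?_⟩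
  rintro ⟨t, ht⟩
  refine hlam (Set.mem_biUnion (Finset.mem_image_of_mem M (Finset.mem_filter.2
    ⟨Finset.mem_univ _, hS⟩)) ⟨t, funext fun i => ht i i.2⟩)

theorem exists_internalVertices_eq_image [LinearOrder ι] {X : ι → Fin n → ℝ}
    {lam : ι → ℝ} (hlam : IsGeneric X lam) : ∃ v : Finset ι → Fin n → ℝ,
      internalVertices X lam = v '' internalBases X ∧ Set.InjOn v (internalBases X) := by
  have hex : ∀ B : Finset ι, IsBasis X B → ∃ v : Fin n → ℝ, v ∈ affFlat X lam B := by
    intro B hB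
    obtain ⟨u, hu⟩ := exists_dotProduct_eq (hB.basis.constr ℝ fun i : B => lam i)
    refine ⟨u, fun i hi => ?_⟩
    rw [← hu, ← hB.basis_apply ⟨i, hi⟩, Module.Basis.constr_basis]
  have hex' : ∀ B : Finset ι, ∃ v : Fin n → ℝ, IsBasis X B → v ∈ affFlat X lam B := by
    intro B
    by_cases hB : IsBasis X B
    · obtain ⟨v, hv⟩ := hex B hB
      exact ⟨v, fun _ => hv⟩
    · exact ⟨0, fun h => absurd h hB⟩
  choose v hv using hex'
  have huniq : ∀ B : Finset ι, IsBasis X B → ∀ w ∈ affFlat X lam B, w = v B := by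
    intro B hB w hw
    rw [← sub_eq_zero]
    refine eq_zero_of_forall_dotProduct hB.2 ?_
    rintro _ ⟨i, hi, rfl⟩
    rw [dotProduct_comm, dotProduct_sub, hw i hi, hv B hB i hi, sub_self]
  have himage : internalVertices X lam = v '' internalBases X := by
    ext w
    constructor
    · rintro ⟨B, hB, hw⟩
      exact ⟨B, hB, (huniq B hB.1 w hw).symm⟩
    · rintro ⟨B, hB, rfl⟩
      exact ⟨B, hB, hv B hB.1⟩
  refine ⟨v, himage, fun B hB B' hB' h => ?_⟩
  have hsub : B' ⊆ B := fun i hi => by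
    by_contra hiB
    refine hlam.dotProduct_ne hB.1 (hv B hB.1) hiB ?_
    rw [h]
    exact hv B' hB'.1 i hi
  exact (Finset.eq_of_subset_of_card_le hsub (by rw [hB.1.card_eq, hB'.1.card_eq])).symm

theorem ncard_internalVertices [LinearOrder ι] {X : ι → Fin n → ℝ} {lam : ι → ℝ}
    (hlam : IsGeneric X lam) :
    (internalVertices X lam).ncard = (internalBases X).ncard := by
  obtain ⟨v, hv, hinj⟩ := exists_internalVertices_eq_image hlam
  rw [hv, hinj.ncard_image]

theorem finite_internalVertices [Fintype ι] [LinearOrder ι] {X : ι → Fin n → ℝ} {lam : ι → ℝ}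
    (hlam : IsGeneric X lam) : (internalVertices X lam).Finite := by
  obtain ⟨v, hv, -⟩ := exists_internalVertices_eq_image hlam
  rw [hv]
  exact (Set.toFinite _).image v

end

/-! ### Least parts of exponential sums, and duality -/

section

variable {n : ℕ} {ι : Type*}

/-! ### Perturbed products -/

theorem coeff_mul_eq_zero_of_le_degree {f g : Poly n} {j k : ℕ}
    (hf : ∀ b : Fin n →₀ ℕ, k ≤ b.degree → coeff b f = 0)
    (hg : ∀ b : Fin n →₀ ℕ, j + 1 ≤ b.degree → coeff b g = 0) {b : Fin n →₀ ℕ}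
    (hb : k + j ≤ b.degree) : coeff b (f * g) = 0 := by
  classical
  rw [coeff_mul]
  refine Finset.sum_eq_zero fun x hx => ?_
  rw [Finset.HasAntidiagonal.mem_antidiagonal] at hx
  by_cases h : k ≤ x.1.degree
  · rw [hf _ h, zero_mul]
  · rw [hg, mul_zero]
    rw [← hx, map_add] at hb
    omega

theorem isHomogeneous_linForm (x : Fin n → ℝ) : (linForm x).IsHomogeneous 1 := by
  refine IsHomogeneous.sum _ _ _ fun i _ => ?_
  simpa using (isHomogeneous_C (Fin n) (x i : ℂ)).mul (isHomogeneous_X ℂ i)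

theorem isHomogeneous_prodForm (X : ι → Fin n → ℝ) (Y : Finset ι) :
    (prodForm X Y).IsHomogeneous Y.card := by
  have := IsHomogeneous.prod Y (fun i => linForm (X i)) (fun _ => 1)
    fun i _ => isHomogeneous_linForm (X i)
  simpa [prodForm] using this

theorem coeff_prod_affForm_sub_prodForm (X : ι → Fin n → ℝ) (lam : ι → ℝ) (Y : Finset ι)
    (b : Fin n →₀ ℕ) (hb : Y.card ≤ b.degree) :
    coeff b (∏ i ∈ Y, affForm (X i) (lam i) - prodForm X Y) = 0 := by
  classical
  induction Y using Finset.induction_on generalizing b with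
  | empty => simp [prodForm]
  | insert x Y hx ih =>
    rw [Finset.card_insert_of_notMem hx] at hb
    set D := ∏ i ∈ Y, affForm (X i) (lam i) - prodForm X Y with hD
    have h : ∏ i ∈ insert x Y, affForm (X i) (lam i) - prodForm X (insert x Y) =
        D * linForm (X x) - C (lam x : ℂ) * (prodForm X Y + D) := by
      rw [Finset.prod_insert hx, prodForm_insert X hx, hD, affForm]
      ring
    rw [h, coeff_sub, coeff_C_mul, coeff_add, ih b (by omega),
      (isHomogeneous_prodForm X Y).coeff_eq_zero (by omega),
      coeff_mul_eq_zero_of_le_degree ih (j := 1) (fun c hc =>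
        (isHomogeneous_linForm (X x)).coeff_eq_zero (by omega)) hb]
    simp

/-! ### Least parts of exponential sums -/

theorem coeff_least (f : Series n) (b : Fin n →₀ ℕ) :
    coeff b (least f) =
      if b.degree = f.order.toNat then MvPowerSeries.coeff b f else 0 := by
  rw [least, MvPowerSeries.coeff_truncTotal_eq_ite, MvPowerSeries.coeff_homogeneousComponent]
  split_ifs with h1 h2 h2
  · rfl
  · rfl
  · omega
  · rfl

theorem coeff_eq_zero_of_degree_lt {f : Series n} {b : Fin n →₀ ℕ}
    (hb : b.degree < f.order.toNat) : MvPowerSeries.coeff b f = 0 := by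
  apply MvPowerSeries.coeff_of_lt_order
  exact (Nat.cast_lt.2 hb).trans_le (ENat.natCast_toNat_le_self _)

theorem least_ne_zero {f : Series n} (hf : f ≠ 0) : least f ≠ 0 := by
  obtain ⟨d, hd, hdeg⟩ := MvPowerSeries.exists_coeff_ne_zero_and_order
    (MvPowerSeries.ne_zero_iff_order_finite.1 hf)
  intro h
  apply hd
  have := coeff_least f d
  rw [h, coeff_zero, if_pos] at this
  · exact this.symm
  · rw [← hdeg, ENat.toNat_natCast]

theorem pairing_eq_zero_of_mem_expSpace {V : Set (Fin n → ℝ)} {f : Series n}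
    (hf : f ∈ expSpace V) {p : Poly n} (hp : ∀ v ∈ V, eval (complexPoint v) p = 0) :
    pairing p f = 0 := by
  have : expSpace V ≤ LinearMap.ker (pairing p) := by
    refine Submodule.span_le.2 ?_
    rintro _ ⟨v, hv, rfl⟩
    exact (pairing_expSeries p _).trans (hp v hv)
  exact this hf

/-- For a monomial q, the pairing of q p_Y with f↓ can only be nonzero if the degree of q p_Y is the
order of f. In that case f↓ may be replaced by f, and p_Y by the product of affine forms, which
vanishes at every vertex because Y meets every internal basis. -/
theorem least_mem_internalD [LinearOrder ι] {X : ι → Fin n → ℝ} {lam : ι → ℝ} {f : Series n}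
    (hf : f ∈ expSpace (internalVertices X lam)) : least f ∈ internalD X := by
  rw [internalD_eq_idealPerp, internalJ, mem_idealPerp_span]
  rintro _ ⟨Y, hY, rfl⟩ q
  induction q using MvPolynomial.induction_on' with
  | add p q hp hq => rw [add_mul, pairing_add_left, hp, hq, add_zero]
  | monomial a c =>
    have hhom : (monomial a c * prodForm X Y).IsHomogeneous (a.degree + Y.card) :=
      (isHomogeneous_monomial c rfl).mul (isHomogeneous_prodForm X Y)
    by_cases hd : a.degree + Y.card = f.order.toNat
    · have h1 : pairing (monomial a c * prodForm X Y) (toSeries n (least f)) =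
          pairing (monomial a c * prodForm X Y) f := by
        rw [pairing_eq_sum, pairing_eq_sum]
        refine Finset.sum_congr rfl fun b hb => ?_
        rw [coeff_toSeries, coeff_least, if_pos]
        by_contra h
        exact (mem_support_iff.1 hb) (hhom.coeff_eq_zero (by omega))
      -- The difference has degree below the order of f, where f has no terms.
      have h2 : pairing (monomial a c * (∏ i ∈ Y, affForm (X i) (lam i) - prodForm X Y)) f = 0 := by
        rw [pairing_eq_sum]
        refine Finset.sum_eq_zero fun b _ => ?_
        by_cases hb : b.degree < f.order.toNat
        · rw [coeff_eq_zero_of_degree_lt hb, mul_zero, mul_zero]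
        · rw [mul_comm (monomial a c), coeff_mul_eq_zero_of_le_degree
            (coeff_prod_affForm_sub_prodForm X lam Y) (j := a.degree) (fun e he => ?_) (by omega),
            zero_mul]
          exact (isHomogeneous_monomial c rfl).coeff_eq_zero (by omega)
      have h3 : pairing (monomial a c * ∏ i ∈ Y, affForm (X i) (lam i)) f = 0 := by
        refine pairing_eq_zero_of_mem_expSpace hf fun v hv => ?_
        obtain ⟨B, hB, hv⟩ := hv
        obtain ⟨i, hi⟩ := hY B hB
        rw [Finset.mem_inter] at hi
        rw [map_mul, map_prod, Finset.prod_eq_zero hi.1, mul_zero]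
        rw [eval_affForm, hv i hi.2, sub_self, Complex.ofReal_zero]
      rw [h1]
      rw [mul_sub, sub_eq_add_neg, pairing_add_left, h3, zero_add, ← neg_one_smul ℂ,
        pairing_smul_left] at h2
      simpa using h2
    · rw [pairing_eq_sum]
      refine Finset.sum_eq_zero fun b hb => ?_
      rw [coeff_toSeries, coeff_least, if_neg, mul_zero, mul_zero]
      intro h
      exact (mem_support_iff.1 hb) (hhom.coeff_eq_zero (by omega))

theorem leastSpace_le_internalD [LinearOrder ι] (X : ι → Fin n → ℝ) (lam : ι → ℝ) :
    leastSpace (internalVertices X lam) ≤ internalD X := by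
  refine Submodule.span_le.2 ?_
  rintro _ ⟨f, hf, rfl⟩
  exact least_mem_internalD hf

/-- The pairing becomes the sum of a! |p_a|² over the support of p. -/
theorem pairing_ne_zero_of_coeff_eq_conj {p : Poly n} (hp : p ≠ 0) {f : Series n}
    (h : ∀ b ∈ p.support, MvPowerSeries.coeff b f = (starRingEnd ℂ) (coeff b p)) :
    pairing p f ≠ 0 := by
  have h1 : pairing p f = ((∑ b ∈ p.support,
      (∏ i : Fin n, ((b i).factorial : ℝ)) * ‖coeff b p‖ ^ 2 : ℝ) : ℂ) := by
    rw [pairing_eq_sum, Complex.ofReal_sum]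
    refine Finset.sum_congr rfl fun b hb => ?_
    rw [h b hb, multiFactorial, mul_left_comm, Complex.mul_conj, Complex.normSq_eq_norm_sq]
    push_cast
    rfl
  rw [h1, Complex.ofReal_ne_zero]
  refine (Finset.sum_pos (fun b hb => mul_pos ?_ ?_) ?_).ne'
  · exact Finset.prod_pos fun i _ => Nat.cast_pos.2 (Nat.factorial_pos _)
  · exact pow_pos (norm_pos_iff.2 (mem_support_iff.1 hb)) 2
  · exact support_nonempty.2 hp

theorem coeff_expSeries_complexPoint_conj (v : Fin n → ℝ) (b : Fin n →₀ ℕ) :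
    (starRingEnd ℂ) (MvPowerSeries.coeff b (expSeries (complexPoint v))) =
      MvPowerSeries.coeff b (expSeries (complexPoint v)) := by
  change (starRingEnd ℂ) (∏ i : Fin n, _) = ∏ i : Fin n, _
  rw [map_prod]
  refine Finset.prod_congr rfl fun i _ => ?_
  simp [complexPoint]

/-- Restriction of the polynomials in `P` to a set of real points. -/
noncomputable def evalMap (V : Set (Fin n → ℝ)) (P : Submodule ℂ (Poly n)) :
    P →ₗ[ℂ] (V → ℂ) :=
  LinearMap.pi fun v => (aeval (complexPoint v) : Poly n →ₐ[ℂ] ℂ).toLinearMap.domRestrict P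

theorem isCorrect_iff_bijective_evalMap (V : Set (Fin n → ℝ)) (P : Submodule ℂ (Poly n)) :
    IsCorrect V P ↔ Function.Bijective (evalMap V P) :=
  Iff.rfl

/-- Evaluations at distinct points are distinct characters of the multiplicative monoid Π, hence
independent by Dedekind. -/
theorem eq_zero_of_forall_sum_eval_eq_zero {V : Set (Fin n → ℝ)} [Fintype V] {c : V → ℂ}
    (h : ∀ p : Poly n, ∑ v, c v * eval (complexPoint v) p = 0) : c = 0 := by
  have hinj : Function.Injective fun v : V =>
      ((eval (complexPoint (v : Fin n → ℝ)) : Poly n →+* ℂ) : Poly n →* ℂ) := by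
    intro v w hvw
    ext i
    have := DFunLike.congr_fun hvw (X i)
    simpa [complexPoint] using this
  have hli := (linearIndependent_monoidHom (Poly n) ℂ).comp _ hinj
  rw [Fintype.linearIndependent_iff] at hli
  funext v
  refine hli c ?_ v
  funext p
  simpa using h p

theorem evalMap_leastSpace_surjective (V : Set (Fin n → ℝ)) [Fintype V] :
    Function.Surjective (evalMap V (leastSpace V)) := by
  classical
  rw [← LinearMap.range_eq_top]
  by_contra hne
  obtain ⟨φ, hφ, hker⟩ := Submodule.exists_le_ker_of_lt_top _ (lt_top_iff_ne_top.2 hne)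
  set c : V → ℂ := fun v => φ (Pi.single v 1) with hc
  have hφc : ∀ g, φ g = ∑ v, c v * g v := by
    intro g
    rw [LinearMap.pi_apply_eq_sum_univ φ g]
    refine Finset.sum_congr rfl fun v _ => ?_
    rw [smul_eq_mul, mul_comm, hc]
    congr 2
    funext w
    simp [Pi.single_apply, eq_comm]
  set f : Series n := ∑ v : V, c v • expSeries (complexPoint v) with hf
  -- The points of V are real, so conjugating the weights conjugates all coefficients. The least
  -- part of f' lies in Π(V), so f annihilates it; positivity then forces f' = 0.
  set f' : Series n := ∑ v : V, (starRingEnd ℂ) (c v) • expSeries (complexPoint v) with hf'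
  have hpair : ∀ p : Poly n, pairing p f = ∑ v, c v * eval (complexPoint v) p := by
    intro p
    rw [hf, map_sum]
    simp only [map_smul, smul_eq_mul, pairing_expSeries]
  have hconj : ∀ b, MvPowerSeries.coeff b f =
      (starRingEnd ℂ) (MvPowerSeries.coeff b f') := by
    intro b
    rw [hf, hf', map_sum, map_sum, map_sum]
    refine Finset.sum_congr rfl fun v _ => ?_
    rw [map_smul, map_smul, smul_eq_mul, smul_eq_mul, map_mul, Complex.conj_conj,
      coeff_expSeries_complexPoint_conj]
  have hmem : least f' ∈ leastSpace V := by
    refine Submodule.subset_span ⟨f', ?_, rfl⟩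
    exact sum_mem fun v _ => Submodule.smul_mem _ _ (Submodule.subset_span ⟨v, v.2, rfl⟩)
  have hzero : pairing (least f') f = 0 := by
    rw [hpair]
    have := hker (LinearMap.mem_range_self (evalMap V (leastSpace V)) ⟨_, hmem⟩)
    rw [LinearMap.mem_ker, hφc] at this
    exact this
  have hf'0 : f' = 0 := by
    by_contra h0
    refine pairing_ne_zero_of_coeff_eq_conj (least_ne_zero h0) (fun b hb => ?_) hzero
    rw [mem_support_iff, coeff_least] at hb
    rw [coeff_least, hconj]
    split_ifs at hb ⊢ with h
    · rfl
    · exact absurd rfl hb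
  have hf0 : f = 0 := by
    ext b
    rw [hconj, hf'0, map_zero, map_zero]
  have hc0 : c = 0 := eq_zero_of_forall_sum_eval_eq_zero fun p => by
    rw [← hpair, hf0, map_zero]
  apply hφ
  ext g
  simp [hφc, hc0]

/-! ### Duality -/

/-- The map `p ↦ ⟨p, ·⟩` from `𝓓₋(X)` to the dual space of `𝓟₋(X)`. -/
noncomputable def internalPairing [Fintype ι] [LinearOrder ι] (X : ι → Fin n → ℝ) :
    internalD X →ₗ[ℂ] Module.Dual ℂ (internalP X) where
  toFun f := ((pairing (f : Poly n)).comp (toSeries n)).domRestrict (internalP X)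
  map_add' f g := by
    ext p
    exact pairing_add_left _ _ _
  map_smul' c f := by
    ext p
    exact pairing_smul_left _ _ _

theorem internalPairing_apply [Fintype ι] [LinearOrder ι] (X : ι → Fin n → ℝ) (f : internalD X)
    (p : internalP X) :
    internalPairing X f p = pairing (f : Poly n) (toSeries n (p : Poly n)) := rfl

/-- An element of 𝓓₋ is orthogonal to 𝓙₋; if it is also orthogonal to 𝓟₋, it is orthogonal to their
sum Π. -/
theorem internalPairing_injective [Fintype ι] [LinearOrder ι] {X : ι → Fin n → ℝ}
    (hX : Submodule.span ℝ (Set.range X) = ⊤) : Function.Injective (internalPairing X) := by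
  refine (injective_iff_map_eq_zero _).2 fun f hf => ?_
  have hfJ : (f : Poly n) ∈ idealPerp (internalJ X) := internalD_eq_idealPerp X ▸ f.2
  refine Subtype.ext (eq_zero_of_pairing_toSeries fun q => ?_)
  obtain ⟨p, hp, j, hj, rfl⟩ :=
    Submodule.mem_sup.1 ((internalP_sup_internalJ hX).ge (Submodule.mem_top (x := q)))
  rw [pairing_add_left, hfJ j hj, add_zero, pairing_toSeries_comm]
  exact DFunLike.congr_fun hf ⟨p, hp⟩

end

end ZonotopalAlgebra

/-! ### Closing the chain of dimensions -/

theorem mainTheorem2 {n : ℕ} {ι : Type*} [Fintype ι] [LinearOrder ι] (X : ι → Fin n → ℝ)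
    (hX0 : ∀ i, X i ≠ 0) (hX : Submodule.span ℝ (Set.range X) = ⊤) :
    -- (1) dimensions
    (FiniteDimensional ℂ (internalP X) ∧
      Module.finrank ℂ (internalP X) = (internalBases X).ncard) ∧
    (FiniteDimensional ℂ (internalD X) ∧
      Module.finrank ℂ (internalD X) = (internalBases X).ncard) ∧
    -- (2) duality under the pairing
    Function.Bijective (fun f : internalD X =>
      (((pairing (f : Poly n)).comp (toSeries n)).domRestrict (internalP X) :
        Module.Dual ℂ (internalP X))) ∧
    -- (3) and (4), for every generic arrangement
    (∀ lam : ι → ℝ, IsGeneric X lam →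
      internalD X = leastSpace (internalVertices X lam) ∧
      IsCorrect (internalVertices X lam) (internalD X) ∧
      IsCorrect (internalVertices X lam) (internalP X)) ∧
    -- (3) continued
    (internalD X).map (toSeries n) = idealKer (internalJ X) ∧
    -- (5)
    (internalP X).map (toSeries n) = idealKer (internalI X) ∧
    -- (6)
    IsCompl (internalP X) ((internalJ X).restrictScalars ℂ) := by
  have key : ∀ lam : ι → ℝ, IsGeneric X lam →
      (FiniteDimensional ℂ (internalP X) ∧
        Module.finrank ℂ (internalP X) = (internalBases X).ncard) ∧
      (FiniteDimensional ℂ (internalD X) ∧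
        Module.finrank ℂ (internalD X) = (internalBases X).ncard) ∧
      internalD X = leastSpace (internalVertices X lam) ∧
      IsCorrect (internalVertices X lam) (internalD X) ∧
      IsCorrect (internalVertices X lam) (internalP X) := by
    intro lam hlam
    set V := internalVertices X lam with hV
    let : Fintype V := (finite_internalVertices hlam).fintype
    have hcard : Module.finrank ℂ (V → ℂ) = (internalBases X).ncard := by
      rw [Module.finrank_fintype_fun_eq_card, ← ncard_internalVertices hlam, ← hV,
        Set.ncard_eq_toFinset_card', Set.toFinset_card]
    have hinjP : Function.Injective (evalMap V (internalP X)) := by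
      refine (injective_iff_map_eq_zero _).2 fun p hp => Subtype.ext ?_
      exact eq_zero_of_eval_internalVertices_eq_zero hX hlam p.2 fun v hv => congrFun hp ⟨v, hv⟩
    have hfinP : FiniteDimensional ℂ (internalP X) :=
      FiniteDimensional.of_injective _ hinjP
    have hfinD : FiniteDimensional ℂ (internalD X) :=
      FiniteDimensional.of_injective _ (internalPairing_injective hX)
    have hle : leastSpace V ≤ internalD X := leastSpace_le_internalD X lam
    have hfinL : FiniteDimensional ℂ (leastSpace V) :=
      Submodule.finiteDimensional_of_le hle
    have h1 := LinearMap.finrank_le_finrank_of_injective hinjP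
    have h2 := LinearMap.finrank_le_finrank_of_injective (internalPairing_injective hX)
    rw [Subspace.dual_finrank_eq] at h2
    have h3 := Submodule.finrank_mono hle
    have hsurj := evalMap_leastSpace_surjective V
    have h4 := LinearMap.finrank_le_finrank_of_surjective hsurj
    -- The bounds `h1` to `h4` close up to #V ≤ dim Π(V) ≤ dim 𝓓₋ ≤ dim 𝓟₋ ≤ #V, so all are
    -- equalities.
    have hDeq : leastSpace V = internalD X := Submodule.eq_of_le_of_finrank_le hle (by omega)
    rw [hDeq] at hsurj
    have hP : Module.finrank ℂ (internalP X) = Module.finrank ℂ (V → ℂ) := by omega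
    have hD : Module.finrank ℂ (internalD X) = Module.finrank ℂ (V → ℂ) := by omega
    refine ⟨⟨hfinP, hP.trans hcard⟩, ⟨hfinD, hD.trans hcard⟩, hDeq.symm, ?_, ?_⟩
    · rw [isCorrect_iff_bijective_evalMap]
      exact ⟨(LinearMap.injective_iff_surjective_of_finrank_eq_finrank hD).2 hsurj, hsurj⟩
    · rw [isCorrect_iff_bijective_evalMap]
      exact ⟨hinjP, (LinearMap.injective_iff_surjective_of_finrank_eq_finrank hP).1 hinjP⟩
  obtain ⟨lam, hlam⟩ := exists_isGeneric X
  obtain ⟨hP, hD, -⟩ := key lam hlam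
  have := hP.1
  have := hD.1
  have hbij : Function.Bijective (internalPairing X) := by
    have hinj := internalPairing_injective hX
    refine ⟨hinj, (LinearMap.injective_iff_surjective_of_finrank_eq_finrank ?_).1 hinj⟩
    rw [Subspace.dual_finrank_eq, hP.2, hD.2]
  refine ⟨hP, hD, hbij, fun lam hlam => (key lam hlam).2.2, map_internalD_eq_idealKer X,
    map_internalP_eq_idealKer hX, ?_, codisjoint_iff.2 (internalP_sup_internalJ hX)⟩
  -- Every functional on 𝓟₋ is pairing with an element of 𝓓₋, and such an element kills 𝓙₋; so a
  -- common element of 𝓟₋ and 𝓙₋ is killed by the whole dual.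
  refine Submodule.disjoint_def.2 fun p hpP hpJ => ?_
  have h0 : (⟨p, hpP⟩ : internalP X) = 0 := by
    refine (Module.forall_dual_apply_eq_zero_iff ℂ _).1 fun φ => ?_
    obtain ⟨f, rfl⟩ := hbij.2 φ
    have hfJ : (f : Poly n) ∈ idealPerp (internalJ X) := internalD_eq_idealPerp X ▸ f.2
    rw [internalPairing_apply, pairing_toSeries_comm]
    exact hfJ p hpJ
  exact congrArg Subtype.val h0
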